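/- **Setting.** Let $Q>1$ and $s>1$. Let $(Z,d)$ be a compact, connected metric space with a Borel measure $\mu$ that is Ahlfors $Q$-regular with constants $a,b>0$: $a r^Q\le \mu(B(z,r))\le b r^Q$ for all $z\in Z$ and $0<r\le \operatorname{diam} Z$. A path is a continuous map $\gamma:[0,1]\to Z$, and a path family $\Gamma$ is any set of paths. *Modulus.* $\operatorname{mod}_Q(\Gamma)=\inf\int_Z\rho^Q\,d\mu$ over all Borel $\rho:Z\to[0,\infty]$ with $\int_\gamma\rho\ge 1$ (arclength integral) for every rectifiable $\gamma\in\Gamma$. *Hyperbolic filling with parameter $s$.* Fix a normalising scale $R>\operatorname{diam}Z$ (so that $d/R$ has diameter less than $1$; $R=1$ is allowed if $\operatorname{diam}Z<1$). For each $k\in\{0,1,2,\dots\}$ let $P_k\subseteq Z$ be a maximal set whose distinct points have mutual distance at least $Rs^{-k}$. The vertex set $V$ is the disjoint union of the $P_k$; a vertex $v$ of level $k$ with center $p\in P_k$ has the ball $B_v=B(p,2Rs^{-k})$. Two distinct vertices are joined by an edge if their levels differ by at most one and the closures of their balls intersect. *Weak covering capacity.* An expanding sequence of covers is a sequence of finite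 sets $S_n\subseteq V$ such that $Z=\bigcup_{v\in S_n}B_v$ for every $n$ and, for every finite $A\subseteq V$, $S_n\cap A=\emptyset$ for all large $n$. A projection of $\gamma$ onto $S\subseteq V$ is a partition $0=t_0<\dots<t_m=1$ together with $v_1,\dots,v_m\in S$ such that $\gamma([t_{k-1},t_k])\subseteq B_{v_k}$ for all $k$. A function $\tau:V\to[0,\infty]$ is admissible for $\gamma$ if for every expanding sequence of covers $(S_n)$ $$\liminf_{n\to\infty}\ \inf\Big\{\sum_{k=1}^m\tau(v_k)\Big\}\ \ge 1,$$ the infimum being over all projections of $\gamma$ onto $S_n$. With $\|\tau\|_{Q,\infty}=\inf\{K>0:\#\{v:\tau(v)>\lambda\}\le K^Q/\lambda^Q\text{ for all }\lambda>0\}$, put $$\operatorname{wccap}_Q(\Gamma)=\inf\{\|\tau\|_{Q,\infty}^Q:\ \tau\text{ is admissible for every }\gamma\in\Gamma\}.$$ (Infima of empty sets are $\infty$.) **Theorem.** There are constants $c,C>0$, depending only on $Q$, $s$, $a$ and $b$, such that for every $(Z,d,\mu)$ as above, every hyperbolic filling of $Z$ with parameter $s$ and every path family $\Gamma$ in $Z$,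 $$c\,\operatorname{mod}_Q(\Gamma)\ \le\ \operatorname{wccap}_Q(\Gamma)\ \le\ C\,\operatorname{mod}_Q(\Gamma).$$ -/

import Mathlib

open Set Filter MeasureTheory
open scoped ENNReal NNReal Topology unitInterval

universe u

noncomputable section

namespace WeakCovering

/-! ### Ahlfors regularity, path integrals and modulus -/

/-- `μ` is Ahlfors `Q`-regular with constants `a` and `b`:
`a r^Q ≤ μ(B(z, r)) ≤ b r^Q` for all `z` and all `0 < r ≤ diam Z`. -/
def IsAhlforsRegular {Z : Type u} [MetricSpace Z] [MeasurableSpace Z]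
    (μ : Measure Z) (Q a b : ℝ) : Prop :=
  0 < a ∧ 0 < b ∧
    ∀ (z : Z) (r : ℝ), 0 < r → r ≤ Metric.diam (univ : Set Z) →
      ENNReal.ofReal (a * r ^ Q) ≤ μ (Metric.ball z r) ∧
        μ (Metric.ball z r) ≤ ENNReal.ofReal (b * r ^ Q)

/-- The length (total variation) of a path `γ : [0, 1] → Z`. -/
def pathLength {Z : Type u} [MetricSpace Z] (γ : C(I, Z)) : ℝ≥0∞ :=
  eVariationOn γ univ

/-- A path is rectifiable if it has finite length. -/
def IsRectifiable {Z : Type u} [MetricSpace Z] (γ : C(I, Z)) : Prop :=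
  pathLength γ ≠ ∞

/-- The path integral `∫_γ ρ` of a rectifiable path, that is, the integral of `ρ` along the
arclength parameterization of `γ`, which is defined on `[0, length γ]`. -/
def pathIntegral {Z : Type u} [MetricSpace Z] (ρ : Z → ℝ≥0∞) (γ : C(I, Z)) : ℝ≥0∞ :=
  ∫⁻ t in Icc (0 : ℝ) (pathLength γ).toReal, ρ (naturalParameterization γ univ 0 t)

/-- `ρ` is admissible for the modulus of the path family `Γ`. -/
def ModAdmissible {Z : Type u} [MetricSpace Z] [MeasurableSpace Z]
    (Γ : Set C(I, Z)) (ρ : Z → ℝ≥0∞) : Prop :=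
  Measurable ρ ∧ ∀ γ ∈ Γ, IsRectifiable γ → 1 ≤ pathIntegral ρ γ

/-- The `p`-modulus of a path family; it is `∞` if there is no admissible function. -/
def modulus {Z : Type u} [MetricSpace Z] [MeasurableSpace Z]
    (μ : Measure Z) (p : ℝ) (Γ : Set C(I, Z)) : ℝ≥0∞ :=
  ⨅ (ρ : Z → ℝ≥0∞) (_ : ModAdmissible Γ ρ), ∫⁻ z, ρ z ^ p ∂μ

/-! ### The weak `ℓ^p`-norm -/

/-- The weak `ℓ^p`-norm of `f : X → [0, ∞]`: the infimum of all `C > 0` such that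
`#{x : f x > l} ≤ C^p / l^p` for all `l > 0` (and `∞` if there is no such `C`). -/
def weakNorm {X : Type u} (p : ℝ) (f : X → ℝ≥0∞) : ℝ≥0∞ :=
  ⨅ (C : ℝ≥0) (_ : 0 < C ∧ ∀ l : ℝ≥0, 0 < l →
      (({x : X | (l : ℝ≥0∞) < f x}.encard : ℕ∞) : ℝ≥0∞) ≤ (C : ℝ≥0∞) ^ p / (l : ℝ≥0∞) ^ p),
    (C : ℝ≥0∞)

/-! ### Hyperbolic fillings -/

/-- The data of a hyperbolic filling of `Z` with parameter `s`: for each level `k`, a set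
`P k` of centers that is `s^{-k}`-separated and maximal with this property, for the metric
rescaled to have diameter less than `1`. The rescaled metric is `dist / R`, where
`R = scale > diam Z`; one may take `R = 1` if `diam Z < 1`. -/
structure HyperbolicFilling (Z : Type u) [MetricSpace Z] (s : ℝ) where
  scale : ℝ
  diam_lt_scale : Metric.diam (univ : Set Z) < scale
  P : ℕ → Set Z
  maximal_separated : ∀ k : ℕ,
    Maximal (fun A : Set Z => A.Pairwise fun x y => scale * s ^ (-(k : ℤ)) ≤ dist x y) (P k)

namespace HyperbolicFilling

variable {Z : Type u} [MetricSpace Z] {s : ℝ}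

/-- The vertex set: the disjoint union of the levels. -/
def Vertex (F : HyperbolicFilling Z s) : Type u :=
  Σ k : ℕ, F.P k

/-- The level of a vertex. -/
def level (F : HyperbolicFilling Z s) (v : F.Vertex) : ℕ := v.1

/-- The center of a vertex. -/
def center (F : HyperbolicFilling Z s) (v : F.Vertex) : Z := (v.2 : Z)

/-- The ball `B_v` of a vertex `v` of level `k`; its radius is `2 s^{-k}` in the rescaled
metric. -/
def ball (F : HyperbolicFilling Z s) (v : F.Vertex) : Set Z :=
  Metric.ball (F.center v) (2 * (F.scale * s ^ (-(F.level v : ℤ))))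

/-- The edges of the filling join distinct vertices whose levels differ by at most one and whose
closed balls meet. (The weak covering capacity only involves the vertices and their balls.) -/
def graph (F : HyperbolicFilling Z s) : SimpleGraph F.Vertex where
  Adj v w := v ≠ w ∧ (F.level v ≤ F.level w + 1 ∧ F.level w ≤ F.level v + 1) ∧
    (closure (F.ball v) ∩ closure (F.ball w)).Nonempty
  symm := ⟨fun _ _ h => ⟨h.1.symm, h.2.1.symm, by rw [inter_comm]; exact h.2.2⟩⟩
  loopless := ⟨fun _ h => h.1 rfl⟩

/-- An expanding sequence of covers: each `S n` is finite, its balls cover `Z`, and the `S n`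
eventually avoid every finite set of vertices. -/
structure IsExpandingCovers (F : HyperbolicFilling Z s) (S : ℕ → Set F.Vertex) : Prop where
  finite : ∀ n, (S n).Finite
  covers : ∀ n, (⋃ v ∈ S n, F.ball v) = univ
  expanding : ∀ A : Set F.Vertex, A.Finite → ∀ᶠ n in atTop, S n ∩ A = ∅

/-- A projection of the path `γ` onto `S`: a partition `0 = t 0 < ⋯ < t m = 1` and vertices
`v 0, …, v (m - 1)` in `S` such that `γ` maps `[t k, t (k + 1)]` into the ball of `v k`. -/
structure Projection (F : HyperbolicFilling Z s) (γ : C(I, Z)) (S : Set F.Vertex) where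
  m : ℕ
  t : Fin (m + 1) → I
  strictMono : StrictMono t
  t_zero : t 0 = 0
  t_last : t (Fin.last m) = 1
  v : Fin m → F.Vertex
  v_mem : ∀ k, v k ∈ S
  image_subset : ∀ k : Fin m, γ '' Icc (t k.castSucc) (t k.succ) ⊆ F.ball (v k)

/-- The `τ`-length of a projection. -/
def Projection.tauLength {F : HyperbolicFilling Z s} {γ : C(I, Z)} {S : Set F.Vertex}
    (P : F.Projection γ S) (τ : F.Vertex → ℝ≥0∞) : ℝ≥0∞ :=
  ∑ k : Fin P.m, τ (P.v k)

/-- `τ` is admissible for `γ`: relative to every expanding sequence of covers `S`, the lower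
limit of the infimal `τ`-length of the projections of `γ` onto `S n` is at least one. -/
def Admissible (F : HyperbolicFilling Z s) (τ : F.Vertex → ℝ≥0∞) (γ : C(I, Z)) : Prop :=
  ∀ S : ℕ → Set F.Vertex, F.IsExpandingCovers S →
    1 ≤ liminf (fun n => ⨅ P : F.Projection γ (S n), P.tauLength τ) atTop

/-- The weak covering `p`-capacity of a path family `Γ`. All paths in `Γ`, rectifiable or not,
are tested. -/
def weakCoveringCapacity (F : HyperbolicFilling Z s) (p : ℝ) (Γ : Set C(I, Z)) : ℝ≥0∞ :=
  ⨅ (τ : F.Vertex → ℝ≥0∞) (_ : ∀ γ ∈ Γ, F.Admissible τ γ), weakNorm p τ ^ p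

end HyperbolicFilling

end WeakCovering

end

/-! Both inequalities translate between densities ρ on Z and weights τ on vertices through τ(v) ≈
r_v ρ on B_v, where r_v is the separation scale of the level of v.

Capacity below modulus. By Vitali–Carathéodory, ρ^Q + κ lies below a lower semicontinuous g of
almost the same integral; put τ(v) = 4 r_v inf_{B_v} g^{1/Q} on fine levels. Chords of partitions
with small oscillation exhaust the length (`exists_lt_sum_edist`), so on rectifiable paths the
τ-sums asymptotically dominate the integral of g^{1/Q}, while on nonrectifiable paths the lower
bound κ makes them large (`admissible_of_lowerSemicontinuous`). For the weak norm, τ(v) > l forces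
r_v^{-Q} < 4^Q g / l^Q on all of B_v. By bounded overlap, counting such v reduces to integrating a
geometric series in r_k^{-Q} cut off at 4^Q g(x) / l^Q, and such a series is comparable to its
cutoff (`encard_lt_le`).

Modulus below capacity. The ℓ^Q-energy of a weak ℓ^Q weight of norm at most K over n points is O(K^Q
log n) for large n. Levels N, ..., 2N hold at most exponentially many vertices, so their total
energy is O(N K^Q) and one of these N + 1 levels has energy O(K^Q) (`exists_level_sum_le`). Along
such levels, the functions sup_v (τ(v) / r_v) 1_{B_v} have bounded energy, and cutting a rectifiable
path into pieces of equal length shows that four times these functions eventually have integral at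
least one on it. "Eventually" depends on the path, so the family is exhausted by increasing
subfamilies; `modulus_iUnion_le`, a consequence of uniform convexity, passes the bound to their
union. -/

noncomputable section

namespace WeakCovering

/-! ### Arclength of rectifiable paths -/

section Arclength

variable {Z : Type u} [MetricSpace Z] {γ : C(I, Z)}

/-- The length of the initial piece `γ|[0, t]` of a rectifiable path. -/
def arclength (γ : C(I, Z)) (t : I) : ℝ :=
  variationOnFromTo γ univ 0 t

lemma IsRectifiable.locallyBoundedVariationOn (h : IsRectifiable γ) :
    LocallyBoundedVariationOn γ univ :=
  BoundedVariationOn.locallyBoundedVariationOn h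

lemma arclength_zero (γ : C(I, Z)) : arclength γ 0 = 0 :=
  variationOnFromTo.self _ _ _

lemma arclength_one (γ : C(I, Z)) : arclength γ 1 = (pathLength γ).toReal := by
  rw [arclength, variationOnFromTo.eq_of_le _ _ zero_le_one, pathLength]
  congr 2
  ext x
  simpa using unitInterval.le_one'

lemma IsRectifiable.monotone_arclength (h : IsRectifiable γ) : Monotone (arclength γ) :=
  monotoneOn_univ.1 (variationOnFromTo.monotoneOn h.locallyBoundedVariationOn (mem_univ 0))

lemma IsRectifiable.arclength_sub (h : IsRectifiable γ) {x y : I} (hxy : x ≤ y) :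
    ENNReal.ofReal (arclength γ y - arclength γ x) = eVariationOn γ (Icc x y) := by
  have hl := h.locallyBoundedVariationOn
  rw [arclength, arclength, variationOnFromTo.sub_right hl (mem_univ _) (mem_univ _) (mem_univ _),
    variationOnFromTo.eq_of_le _ _ hxy, ENNReal.ofReal_toReal (hl _ _ (mem_univ _) (mem_univ _)),
    univ_inter]

/-- At a point of continuity of a function of bounded variation, the variations over shrinking
one-sided intervals tend to zero; their sum dominates the increment of arclength. -/
lemma IsRectifiable.continuous_arclength (h : IsRectifiable γ) : Continuous (arclength γ) := by
  rw [continuous_iff_continuousAt]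
  intro x
  have hb : BoundedVariationOn γ univ := h
  have hr := hb.tendsto_eVariationOn_Icc_zero_right x γ.continuous.continuousWithinAt
  have hl := hb.tendsto_eVariationOn_Icc_zero_left (x := x) γ.continuous.continuousWithinAt
  rw [nhdsWithin_univ] at hr hl
  simp only [univ_inter] at hr hl
  have key : Tendsto (fun y => edist (arclength γ y) (arclength γ x)) (𝓝 x) (𝓝 0) := by
    refine tendsto_of_tendsto_of_tendsto_of_le_of_le tendsto_const_nhds
      (by simpa using hr.add hl) (fun _ => zero_le) fun y => ?_
    rcases le_total x y with hxy | hxy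
    · rw [edist_dist, Real.dist_eq, abs_of_nonneg (sub_nonneg.2 (h.monotone_arclength hxy)),
        h.arclength_sub hxy]
      exact le_self_add
    · rw [edist_comm, edist_dist, Real.dist_eq,
        abs_of_nonneg (sub_nonneg.2 (h.monotone_arclength hxy)), h.arclength_sub hxy]
      exact le_add_self
  exact tendsto_iff_edist_tendsto_0.2 key

lemma IsRectifiable.exists_arclength_eq (h : IsRectifiable γ) {x y : I} (hxy : x ≤ y) {l : ℝ}
    (hl : l ∈ Icc (arclength γ x) (arclength γ y)) : ∃ w ∈ Icc x y, arclength γ w = l :=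
  intermediate_value_Icc hxy h.continuous_arclength.continuousOn hl

lemma IsRectifiable.naturalParameterization_arclength (h : IsRectifiable γ) (x : I) :
    naturalParameterization γ univ 0 (arclength γ x) = γ x :=
  edist_eq_zero.1
    (edist_naturalParameterization_eq_zero h.locallyBoundedVariationOn (mem_univ _) (mem_univ _))

/-- The parameterization is 1-Lipschitz there. Continuity supplies the measurability needed for
monotone convergence along the path. -/
lemma IsRectifiable.continuousOn_naturalParameterization (h : IsRectifiable γ) :
    ContinuousOn (naturalParameterization γ univ 0) (Icc 0 (pathLength γ).toReal) := by
  have hL : LipschitzOnWith 1 (naturalParameterization γ univ 0)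
      (Icc 0 (pathLength γ).toReal) := by
    intro x hx y hy
    rw [← arclength_zero γ, ← arclength_one] at hx hy
    obtain ⟨s, -, rfl⟩ := h.exists_arclength_eq zero_le_one hx
    obtain ⟨t, -, rfl⟩ := h.exists_arclength_eq zero_le_one hy
    rw [h.naturalParameterization_arclength, h.naturalParameterization_arclength]
    wlog hst : s ≤ t generalizing s t
    · rw [edist_comm, edist_comm (arclength γ s)]
      exact this t hy s hx (le_of_not_ge hst)
    rw [ENNReal.coe_one, one_mul, edist_comm (arclength γ s), edist_dist (arclength γ t),
      Real.dist_eq, abs_of_nonneg (sub_nonneg.2 (h.monotone_arclength hst)), h.arclength_sub hst]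
    exact eVariationOn.edist_le _ ⟨le_rfl, hst⟩ ⟨hst, le_rfl⟩
  exact hL.continuousOn

/-- A path integral decomposes along a partition of the parameter interval. -/
lemma IsRectifiable.pathIntegral_eq_sum (h : IsRectifiable γ) (ρ : Z → ℝ≥0∞) {t : ℕ → I}
    (ht : Monotone t) {m : ℕ} (h0 : t 0 = 0) (hm : t m = 1) :
    pathIntegral ρ γ = ∑ k ∈ Finset.range m,
      ∫⁻ x in Ioc (arclength γ (t k)) (arclength γ (t (k + 1))),
        ρ (naturalParameterization γ univ 0 x) := by
  have key : ∀ n, ∫⁻ x in Ioc (arclength γ (t 0)) (arclength γ (t n)),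
        ρ (naturalParameterization γ univ 0 x) = ∑ k ∈ Finset.range n,
      ∫⁻ x in Ioc (arclength γ (t k)) (arclength γ (t (k + 1))),
        ρ (naturalParameterization γ univ 0 x) := by
    intro n
    induction n with
    | zero => simp
    | succ n ih =>
      rw [Finset.sum_range_succ, ← ih, ← lintegral_union measurableSet_Ioc,
        Ioc_union_Ioc_eq_Ioc (h.monotone_arclength (ht n.zero_le))
          (h.monotone_arclength (ht n.le_succ))]
      exact Ioc_disjoint_Ioc_of_le le_rfl
  rw [← key, h0, hm, arclength_zero, arclength_one, pathIntegral]
  exact setLIntegral_congr Ioc_ae_eq_Icc.symm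

lemma IsRectifiable.exists_eq_of_mem_Ioc (h : IsRectifiable γ) {x y : I} (hxy : x ≤ y) {l : ℝ}
    (hl : l ∈ Ioc (arclength γ x) (arclength γ y)) :
    ∃ w ∈ Icc x y, naturalParameterization γ univ 0 l = γ w := by
  obtain ⟨w, hw, rfl⟩ := h.exists_arclength_eq hxy (Ioc_subset_Icc_self hl)
  exact ⟨w, hw, h.naturalParameterization_arclength w⟩

lemma IsRectifiable.pathIntegral_le_sum (h : IsRectifiable γ) {ρ : Z → ℝ≥0∞} {t : ℕ → I}
    (ht : Monotone t) {m : ℕ} (h0 : t 0 = 0) (hm : t m = 1) {w : ℕ → ℝ≥0∞}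
    (hw : ∀ k < m, ∀ x ∈ Icc (t k) (t (k + 1)), ρ (γ x) ≤ w k) :
    pathIntegral ρ γ ≤
      ∑ k ∈ Finset.range m, w k * eVariationOn γ (Icc (t k) (t (k + 1))) := by
  rw [h.pathIntegral_eq_sum ρ ht h0 hm]
  refine Finset.sum_le_sum fun k hk => ?_
  rw [← h.arclength_sub (ht k.le_succ), ← Real.volume_Ioc, ← setLIntegral_const]
  refine setLIntegral_mono' measurableSet_Ioc fun x hx => ?_
  obtain ⟨y, hy, hxy⟩ := h.exists_eq_of_mem_Ioc (ht k.le_succ) hx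
  rw [hxy]
  exact hw k (Finset.mem_range.1 hk) y hy

lemma IsRectifiable.sum_le_pathIntegral (h : IsRectifiable γ) {ρ : Z → ℝ≥0∞} {t : ℕ → I}
    (ht : Monotone t) {m : ℕ} (h0 : t 0 = 0) (hm : t m = 1) {w : ℕ → ℝ≥0∞}
    (hw : ∀ k < m, ∀ x ∈ Icc (t k) (t (k + 1)), w k ≤ ρ (γ x)) :
    ∑ k ∈ Finset.range m, w k * eVariationOn γ (Icc (t k) (t (k + 1))) ≤
      pathIntegral ρ γ := by
  rw [h.pathIntegral_eq_sum ρ ht h0 hm]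
  refine Finset.sum_le_sum fun k hk => ?_
  rw [← h.arclength_sub (ht k.le_succ), ← Real.volume_Ioc, ← setLIntegral_const]
  refine setLIntegral_mono' measurableSet_Ioc fun x hx => ?_
  obtain ⟨y, hy, hxy⟩ := h.exists_eq_of_mem_Ioc (ht k.le_succ) hx
  rw [hxy]
  exact hw k (Finset.mem_range.1 hk) y hy

lemma sum_eVariationOn_Icc (γ : C(I, Z)) {t : ℕ → I} (ht : Monotone t) {m : ℕ} (h0 : t 0 = 0)
    (hm : t m = 1) :
    ∑ k ∈ Finset.range m, eVariationOn γ (Icc (t k) (t (k + 1))) = pathLength γ := by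
  rw [eVariationOn.sum' _ ht, h0, hm, pathLength]
  congr 1
  ext x
  simpa using unitInterval.le_one'

/-- The chords of a partition on whose pieces the path oscillates little have total length close
to the length of the path. -/
lemma exists_lt_sum_edist (γ : C(I, Z)) {M : ℝ≥0∞} (hM : M < pathLength γ) :
    ∃ δ : ℝ, 0 < δ ∧ ∀ (t : ℕ → I) (m : ℕ), Monotone t → t 0 = 0 → t m = 1 →
      (∀ k < m, ∀ x ∈ Icc (t k) (t (k + 1)), dist (γ (t k)) (γ x) ≤ δ) →
      M < ∑ k ∈ Finset.range m, edist (γ (t k)) (γ (t (k + 1))) := by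
  by_contra! hcon
  choose t m ht h0 hm hosc hle using fun i : ℕ =>
    hcon (1 / ((i : ℝ) + 1)) Nat.one_div_pos_of_nat
  -- Rounding down to the last partition point: γ ∘ φ i tends to γ pointwise, and its variation is
  -- at most the chord sum of the i-th partition. Lower semicontinuity of the variation then
  -- contradicts `hle`.
  let φ : ℕ → I → I := fun i x => t i (Nat.findGreatest (fun k => t i k ≤ x) (m i))
  have hφ : ∀ i, Monotone (φ i) := fun i x y hxy =>
    ht i (Nat.findGreatest_mono_left (fun k hk => hk.trans hxy) _)
  have hdist : ∀ i x, dist (γ (φ i x)) (γ x) ≤ 1 / ((i : ℝ) + 1) := by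
    intro i x
    set k := Nat.findGreatest (fun k => t i k ≤ x) (m i) with hk
    have hkx : t i k ≤ x :=
      Nat.findGreatest_spec (P := fun k => t i k ≤ x) (Nat.zero_le (m i)) (by simp [h0])
    have hkm : k ≤ m i := Nat.findGreatest_le _
    rcases hkm.lt_or_eq with hlt | heq
    · have : ¬ t i (k + 1) ≤ x :=
        Nat.findGreatest_is_greatest (P := fun k => t i k ≤ x) (Nat.lt_succ_self k) hlt
      exact hosc i k hlt x ⟨hkx, (not_le.1 this).le⟩
    · have hx : x = 1 := le_antisymm x.2.2 (by rw [heq, hm] at hkx; exact hkx)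
      have : φ i x = x := by
        change t i k = x
        rw [heq, hm, hx]
      rw [this, dist_self]
      exact Nat.one_div_pos_of_nat.le
  have hlim : ∀ x ∈ univ, Tendsto (fun i => γ (φ i x)) atTop (𝓝 (γ x)) := fun x _ =>
    tendsto_iff_dist_tendsto_zero.2 (squeeze_zero (fun _ => dist_nonneg) (fun i => hdist i x)
      tendsto_one_div_add_atTop_nhds_zero_nat)
  obtain ⟨i, hi⟩ := (eVariationOn.lowerSemicontinuous_aux hlim hM).exists
  refine absurd (hle i) (not_le.2 (hi.trans_le ?_))
  rw [← eVariationOn.image_range_of_monotone _ (ht i)]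
  exact eVariationOn.comp_le_of_monotoneOn γ (φ i) ((hφ i).monotoneOn _)
    fun x _ => ⟨_, Nat.findGreatest_le _, rfl⟩

end Arclength

/-! ### The modulus of an increasing union -/

section UniformConvexity

/-- A form of the uniform convexity of `L^p`, on the simplex. -/
lemma exists_rpow_gap_simplex {p : ℝ} (hp : 1 < p) {ε : ℝ} (hε : 0 < ε) :
    ∃ C : ℝ, 0 < C ∧ ∀ x ∈ Icc (0 : ℝ) 1,
      |1 - 2 * x| ^ p ≤ ε * (x ^ p + (1 - x) ^ p) +
        C * ((x ^ p + (1 - x) ^ p) / 2 - (1 / 2 : ℝ) ^ p) := by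
  have hp0 : 0 < p := by linarith
  have hc1 : Continuous fun x : ℝ => x ^ p + (1 - x) ^ p :=
    (Real.continuous_rpow_const hp0.le).add
      ((Real.continuous_rpow_const hp0.le).comp (continuous_const.sub continuous_id))
  have hc2 : Continuous fun x : ℝ => |1 - 2 * x| ^ p :=
    (Real.continuous_rpow_const hp0.le).comp (by fun_prop)
  have hgap : ∀ x ∈ Icc (0 : ℝ) 1, 0 ≤ (x ^ p + (1 - x) ^ p) / 2 - (1 / 2 : ℝ) ^ p := by
    intro x hx
    have := (convexOn_rpow hp.le).2 (show x ∈ Ici (0 : ℝ) from hx.1)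
      (show 1 - x ∈ Ici (0 : ℝ) from sub_nonneg.2 hx.2)
      (show (0 : ℝ) ≤ 1 / 2 by norm_num) (show (0 : ℝ) ≤ 1 / 2 by norm_num) (by norm_num)
    simp only [smul_eq_mul] at this
    rw [show 1 / 2 * x + 1 / 2 * (1 - x) = 1 / 2 by ring] at this
    linarith
  -- The compact set where the ε-term alone does not suffice. It misses x = 1/2, so strict convexity
  -- keeps the gap away from zero on it.
  let S : Set ℝ := Icc 0 1 ∩ {x | ε * (x ^ p + (1 - x) ^ p) ≤ |1 - 2 * x| ^ p}
  have hS : IsCompact S :=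
    isCompact_Icc.inter_right (isClosed_le (continuous_const.mul hc1) hc2)
  have hpos : ∀ x ∈ S, 0 < (x ^ p + (1 - x) ^ p) / 2 - (1 / 2 : ℝ) ^ p := by
    rintro x ⟨hx, hx2⟩
    have hne : x ≠ 1 - x := by
      intro h
      have hx' : x = 1 / 2 := by linarith
      subst hx'
      simp only [mem_ofPred_eq] at hx2
      rw [show (1 : ℝ) - 2 * (1 / 2) = 0 by norm_num, abs_zero, Real.zero_rpow hp0.ne'] at hx2
      have : (0 : ℝ) < ε * ((1 / 2) ^ p + (1 - 1 / 2) ^ p) := by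
        refine mul_pos hε (add_pos ?_ ?_) <;> apply Real.rpow_pos_of_pos <;> norm_num
      linarith
    have := (strictConvexOn_rpow hp).2 (show x ∈ Ici (0 : ℝ) from hx.1)
      (show 1 - x ∈ Ici (0 : ℝ) from sub_nonneg.2 hx.2) hne
      (show (0 : ℝ) < 1 / 2 by norm_num) (show (0 : ℝ) < 1 / 2 by norm_num) (by norm_num)
    simp only [smul_eq_mul] at this
    rw [show 1 / 2 * x + 1 / 2 * (1 - x) = 1 / 2 by ring] at this
    linarith
  obtain ⟨c, hc, hcS⟩ : ∃ c : ℝ, 0 < c ∧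
      ∀ x ∈ S, c ≤ (x ^ p + (1 - x) ^ p) / 2 - (1 / 2 : ℝ) ^ p := by
    rcases S.eq_empty_or_nonempty with h | h
    · exact ⟨1, one_pos, by simp [h]⟩
    · obtain ⟨x₀, hx₀, hmin⟩ := hS.exists_isMinOn h
        (f := fun x => (x ^ p + (1 - x) ^ p) / 2 - (1 / 2 : ℝ) ^ p)
        ((hc1.div_const 2).sub continuous_const).continuousOn
      exact ⟨_, hpos x₀ hx₀, fun x hx => hmin hx⟩
  refine ⟨1 / c, by positivity, fun x hx => ?_⟩
  have hg := hgap x hx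
  by_cases hxS : ε * (x ^ p + (1 - x) ^ p) ≤ |1 - 2 * x| ^ p
  · have h1 : |1 - 2 * x| ^ p ≤ 1 := by
      refine Real.rpow_le_one (abs_nonneg _) (abs_le.2 ⟨?_, ?_⟩) hp0.le <;> linarith [hx.1, hx.2]
    have h2 : 1 ≤ 1 / c * ((x ^ p + (1 - x) ^ p) / 2 - (1 / 2 : ℝ) ^ p) := by
      rw [one_div_mul_eq_div, one_le_div hc]
      exact hcS x ⟨hx, hxS⟩
    have h3 : 0 ≤ ε * (x ^ p + (1 - x) ^ p) :=
      mul_nonneg hε.le (add_nonneg (Real.rpow_nonneg hx.1 _)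
        (Real.rpow_nonneg (sub_nonneg.2 hx.2) _))
    linarith
  · have : 0 ≤ 1 / c * ((x ^ p + (1 - x) ^ p) / 2 - (1 / 2 : ℝ) ^ p) := by positivity
    linarith

/-- A form of the uniform convexity of `L^p`: the `p`-th power of a difference is controlled by
the defect of convexity. -/
lemma exists_rpow_gap {p : ℝ} (hp : 1 < p) {ε : ℝ≥0} (hε : 0 < ε) :
    ∃ C : ℝ≥0, ∀ x y : ℝ≥0∞, (y - x) ^ p + C * ((x + y) / 2) ^ p ≤
      (ε + C / 2) * (x ^ p + y ^ p) := by
  have hp0 : 0 < p := by linarith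
  obtain ⟨C, hC, hC'⟩ := exists_rpow_gap_simplex hp (ε := ε) hε
  have real : ∀ x y : ℝ, 0 ≤ x → 0 ≤ y →
      |y - x| ^ p + C * ((x + y) / 2) ^ p ≤ (ε + C / 2) * (x ^ p + y ^ p) := by
    intro x y hx hy
    rcases (add_nonneg hx hy).eq_or_lt with h | h
    · have hx0 : x = 0 := by linarith
      have hy0 : y = 0 := by linarith
      simp [hx0, hy0, Real.zero_rpow hp0.ne']
    -- By homogeneity, dividing by x + y reduces the claim to the simplex.
    · have hu : x / (x + y) ∈ Icc (0 : ℝ) 1 := ⟨by positivity, (div_le_one h).2 (by linarith)⟩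
      have key := mul_le_mul_of_nonneg_left (hC' _ hu) (Real.rpow_nonneg h.le p)
      have e1 : (x + y) ^ p * |1 - 2 * (x / (x + y))| ^ p = |y - x| ^ p := by
        rw [← Real.mul_rpow h.le (abs_nonneg _), ← abs_of_pos h, ← abs_mul, abs_of_pos h]
        congr 2
        field_simp
        ring
      have e2 : (x + y) ^ p * (x / (x + y)) ^ p = x ^ p := by
        rw [← Real.mul_rpow h.le hu.1]
        congr 1
        field_simp
      have e3 : (x + y) ^ p * (1 - x / (x + y)) ^ p = y ^ p := by
        rw [← Real.mul_rpow h.le (sub_nonneg.2 hu.2)]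
        congr 1
        field_simp
        ring
      have e4 : (x + y) ^ p * (1 / 2 : ℝ) ^ p = ((x + y) / 2) ^ p := by
        rw [← Real.mul_rpow h.le (by norm_num)]
        congr 1
        ring
      rw [e1] at key
      have : (x + y) ^ p * (ε * ((x / (x + y)) ^ p + (1 - x / (x + y)) ^ p) +
          C * (((x / (x + y)) ^ p + (1 - x / (x + y)) ^ p) / 2 - (1 / 2 : ℝ) ^ p)) =
          ε * (x ^ p + y ^ p) + C * ((x ^ p + y ^ p) / 2 - ((x + y) / 2) ^ p) := by
        rw [← e2, ← e3, ← e4]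
        ring
      rw [this] at key
      linarith
  refine ⟨C.toNNReal, fun x y => ?_⟩
  have hε' : ((ε : ℝ≥0∞) + (C.toNNReal : ℝ≥0∞) / 2) ≠ 0 := by simp [hε.ne']
  by_cases hx : x = ∞
  · simp [hx, ENNReal.top_rpow_of_pos hp0, ENNReal.mul_top hε']
  by_cases hy : y = ∞
  · simp [hy, ENNReal.top_rpow_of_pos hp0, ENNReal.mul_top hε']
  lift x to ℝ≥0 using hx
  lift y to ℝ≥0 using hy
  have h2 : ((2 : ℝ≥0) : ℝ≥0∞) = 2 := rfl
  rw [← ENNReal.coe_sub, ← ENNReal.coe_add, ← h2, ← ENNReal.coe_div two_ne_zero,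
    ← ENNReal.coe_div two_ne_zero, ← ENNReal.coe_rpow_of_nonneg _ hp0.le,
    ← ENNReal.coe_rpow_of_nonneg _ hp0.le, ← ENNReal.coe_rpow_of_nonneg _ hp0.le,
    ← ENNReal.coe_rpow_of_nonneg _ hp0.le]
  norm_cast
  rw [← NNReal.coe_le_coe]
  push_cast
  rw [Real.coe_toNNReal _ hC.le]
  refine le_trans ?_ (real x y x.2 y.2)
  gcongr
  rw [NNReal.coe_sub_def]
  exact max_le (le_abs_self _) (abs_nonneg _)

end UniformConvexity

/-! ### Almost minimizers of the energy -/

section Modulus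

lemma pathIntegral_mono {Z : Type u} [MetricSpace Z] {γ : C(I, Z)} {ρ ρ' : Z → ℝ≥0∞} (h : ∀ z, ρ z ≤ ρ' z) :
    pathIntegral ρ γ ≤ pathIntegral ρ' γ :=
  lintegral_mono fun _ => h _

variable {Z : Type u} [MetricSpace Z] [MeasurableSpace Z] {μ : Measure Z} {p : ℝ}

lemma ModAdmissible.mono {Γ Γ' : Set C(I, Z)} (h : Γ ⊆ Γ') {ρ : Z → ℝ≥0∞}
    (hρ : ModAdmissible Γ' ρ) : ModAdmissible Γ ρ :=
  ⟨hρ.1, fun γ hγ => hρ.2 γ (h hγ)⟩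

lemma modulus_mono {Γ Γ' : Set C(I, Z)} (h : Γ ⊆ Γ') : modulus μ p Γ ≤ modulus μ p Γ' :=
  le_iInf₂ fun ρ hρ => iInf₂_le ρ (hρ.mono h)

/-- Superadditivity of the lower integral is enough, so f and g need not be measurable along the
path. -/
lemma ModAdmissible.midpoint {Γ : Set C(I, Z)} {f g : Z → ℝ≥0∞} (hf : ModAdmissible Γ f)
    (hg : ModAdmissible Γ g) : ModAdmissible Γ fun z => (f z + g z) / 2 := by
  refine ⟨(hf.1.add hg.1).div_const 2, fun γ hγ hr => ?_⟩
  have h2 : (2 : ℝ≥0∞)⁻¹ ≠ ∞ := by simp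
  calc (1 : ℝ≥0∞) = 2⁻¹ * 1 + 2⁻¹ * 1 := by rw [mul_one, ENNReal.inv_two_add_inv_two]
    _ ≤ 2⁻¹ * pathIntegral f γ + 2⁻¹ * pathIntegral g γ := by
      gcongr
      exacts [hf.2 γ hγ hr, hg.2 γ hγ hr]
    _ ≤ pathIntegral (fun z => (f z + g z) / 2) γ := by
      rw [pathIntegral, pathIntegral, ← lintegral_const_mul' _ _ h2, ← lintegral_const_mul' _ _ h2]
      refine (le_lintegral_add _ _).trans (lintegral_mono fun t => le_of_eq ?_)
      beta_reduce
      rw [ENNReal.div_eq_inv_mul, mul_add]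

lemma exists_modAdmissible_lintegral_le {Γ : Set C(I, Z)} (h : modulus μ p Γ ≠ ∞) {η : ℝ≥0∞}
    (hη : η ≠ 0) : ∃ ρ, ModAdmissible Γ ρ ∧ ∫⁻ z, ρ z ^ p ∂μ ≤ modulus μ p Γ + η := by
  have : modulus μ p Γ < modulus μ p Γ + η := ENNReal.lt_add_right h hη
  rw [modulus, iInf_lt_iff] at this
  obtain ⟨ρ, hρ⟩ := this
  obtain ⟨hadm, hlt⟩ := iInf_lt_iff.1 hρ
  exact ⟨ρ, hadm, hlt.le⟩

/-- Functions that almost minimize the `p`-energy among the admissible functions of an increasing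
sequence of path families form a Cauchy sequence. -/
lemma exists_forall_lintegral_sub_rpow_le (hp : 1 < p) {Γ : ℕ → Set C(I, Z)}
    (hΓ : Monotone Γ) {B : ℝ≥0∞} (hB0 : B ≠ 0) (hB : B ≠ ∞) (hmod : ∀ n, modulus μ p (Γ n) ≤ B)
    {f : ℕ → Z → ℝ≥0∞} (hf : ∀ n, ModAdmissible (Γ n) (f n))
    (hint : ∀ n, ∫⁻ z, f n z ^ p ∂μ ≤ modulus μ p (Γ n) + B / (n + 1)) {e : ℝ≥0∞} (he : e ≠ 0) :
    ∃ N, ∀ n ≥ N, ∀ m ≥ n, ∫⁻ z, (f m z - f n z) ^ p ∂μ ≤ e := by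
  have hp0 : 0 ≤ p := by linarith
  set d : ℕ → ℝ≥0∞ := fun n => modulus μ p (Γ n) with hd
  have hdm : Monotone d := fun i j hij => modulus_mono (hΓ hij)
  -- Each of the two energies is at most a modulus plus an error, hence at most 2B; this gives the
  -- factor 4B.
  obtain ⟨ε, hε0, hε⟩ : ∃ ε : ℝ≥0, 0 < ε ∧ ε * (4 * B) ≤ e / 2 := by
    have h4 : 4 * B ≠ ∞ := ENNReal.mul_ne_top (by simp) hB
    obtain ⟨ε, hε0, hε⟩ := ENNReal.exists_nnreal_pos_mul_lt h4 (ENNReal.half_pos he).ne'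
    exact ⟨ε, hε0, hε.le⟩
  obtain ⟨C, hC⟩ := exists_rpow_gap hp hε0
  have hsup : (⨆ n, d n) ≠ ∞ := (iSup_le hmod).trans_lt hB.lt_top |>.ne
  -- the total defect tends to zero
  have hlim : Tendsto (fun n : ℕ => (C : ℝ≥0∞) / 2 * ((⨆ n, d n) - d n + 2 * (B / (n + 1)))) atTop
      (𝓝 0) := by
    have h1 : Tendsto (fun n => (⨆ n, d n) - d n) atTop (𝓝 0) := by
      have := ENNReal.Tendsto.sub (tendsto_const_nhds (x := ⨆ n, d n)) (tendsto_atTop_iSup hdm)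
        (Or.inl hsup)
      simpa using this
    have h2 : Tendsto (fun n : ℕ => B / ((n : ℝ≥0∞) + 1)) atTop (𝓝 0) := by
      have h3 : Tendsto (fun n : ℕ => ((n : ℝ≥0∞) + 1)) atTop (𝓝 ∞) :=
        ENNReal.tendsto_nat_nhds_top.comp (tendsto_add_atTop_nat 1) |>.congr (by simp)
      have := ENNReal.Tendsto.div (tendsto_const_nhds (x := B)) (Or.inl hB0) h3 (Or.inr hB)
      simpa using this
    have h3 := h1.add (ENNReal.Tendsto.const_mul h2 (Or.inr (by simp : (2 : ℝ≥0∞) ≠ ∞)))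
    have h4 := ENNReal.Tendsto.const_mul h3
      (Or.inr (ENNReal.div_ne_top ENNReal.coe_ne_top two_ne_zero : (C : ℝ≥0∞) / 2 ≠ ∞))
    simpa using h4
  obtain ⟨N, hN⟩ := eventually_atTop.1 (hlim.eventually_le_const (ENNReal.half_pos he))
  refine ⟨N, fun n hn m hm => ?_⟩
  have hBn : B / (n + 1) ≤ B := ENNReal.div_le_of_le_mul (le_mul_of_one_le_right' (by simp))
  have hfn : ∫⁻ z, f n z ^ p ∂μ ≤ 2 * B := by
    rw [two_mul]; exact (hint n).trans (add_le_add (hmod n) hBn)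
  have hfm' : ∫⁻ z, f m z ^ p ∂μ ≤ d m + B / (n + 1) :=
    (hint m).trans (add_le_add le_rfl (by gcongr))
  have hfm : ∫⁻ z, f m z ^ p ∂μ ≤ 2 * B := by
    rw [two_mul]; exact hfm'.trans (add_le_add (hmod m) hBn)
  -- The midpoint competes for the smaller family, so its energy cannot drop below d n. As both
  -- energies are close to d n, the convexity defect is small.
  have hmid : d n ≤ ∫⁻ z, ((f n z + f m z) / 2) ^ p ∂μ :=
    iInf₂_le _ ((hf n).midpoint ((hf m).mono (hΓ hm)))
  have hineq : ∫⁻ z, (f m z - f n z) ^ p ∂μ + C * d n ≤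
      (ε + C / 2) * (∫⁻ z, f n z ^ p ∂μ + ∫⁻ z, f m z ^ p ∂μ) := by
    have hmn := (hf n).1
    have hmm := (hf m).1
    calc ∫⁻ z, (f m z - f n z) ^ p ∂μ + C * d n
        ≤ ∫⁻ z, (f m z - f n z) ^ p ∂μ + C * ∫⁻ z, ((f n z + f m z) / 2) ^ p ∂μ := by gcongr
      _ = ∫⁻ z, ((f m z - f n z) ^ p + C * ((f n z + f m z) / 2) ^ p) ∂μ := by
        rw [← lintegral_const_mul' _ _ ENNReal.coe_ne_top, ← lintegral_add_left]
        exact (hmm.sub hmn).pow_const p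
      _ ≤ ∫⁻ z, (ε + C / 2) * (f n z ^ p + f m z ^ p) ∂μ := lintegral_mono fun z => hC _ _
      _ = _ := by
        rw [lintegral_const_mul' _ _ (by simp [ENNReal.div_eq_top]),
          lintegral_add_left (hmn.pow_const p)]
  have hdn : d n ≠ ∞ := ((hmod n).trans_lt hB.lt_top).ne
  have hCd : (C : ℝ≥0∞) * d n ≠ ∞ := ENNReal.mul_ne_top ENNReal.coe_ne_top hdn
  have hdm' : d m ≤ d n + ((⨆ n, d n) - d n) := by
    rw [add_tsub_cancel_of_le (le_iSup d n)]
    exact le_iSup d m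
  refine (ENNReal.add_le_add_iff_right hCd).1 (hineq.trans ?_)
  rw [add_mul]
  calc (ε : ℝ≥0∞) * (∫⁻ z, f n z ^ p ∂μ + ∫⁻ z, f m z ^ p ∂μ) +
        C / 2 * (∫⁻ z, f n z ^ p ∂μ + ∫⁻ z, f m z ^ p ∂μ)
      ≤ ε * (2 * B + 2 * B) + C / 2 * ((d n + B / (n + 1)) +
        (d n + ((⨆ n, d n) - d n) + B / (n + 1))) := by
        gcongr
        · exact hint n
        · exact hfm'.trans (add_le_add hdm' le_rfl)
    _ = ε * (4 * B) + C / 2 * ((⨆ n, d n) - d n + 2 * (B / (n + 1))) + C / 2 * (d n * 2) := by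
        ring
    _ ≤ e / 2 + e / 2 + C / 2 * (d n * 2) := by
        gcongr
        exact hN n hn
    _ = e + C * d n := by
        rw [ENNReal.add_halves, mul_comm (d n), ← mul_assoc,
          ENNReal.div_mul_cancel two_ne_zero (by simp)]

/-- Up to a multiplicative constant, the modulus of an increasing union is bounded by the moduli
of the members. -/
lemma modulus_iUnion_le (hp : 1 < p) {Γ : ℕ → Set C(I, Z)} (hΓ : Monotone Γ) {B : ℝ≥0∞}
    (hB0 : B ≠ 0) (hB : B ≠ ∞) (hmod : ∀ n, modulus μ p (Γ n) ≤ B) :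
    modulus μ p (⋃ n, Γ n) ≤ 2 ^ p * (3 * B) := by
  have hp0 : 0 < p := by linarith
  choose f hf hint using fun n : ℕ => exists_modAdmissible_lintegral_le
    (μ := μ) (p := p) (Γ := Γ n) ((hmod n).trans_lt hB.lt_top).ne
    (ENNReal.div_pos hB0 (by simp : ((n : ℝ≥0∞) + 1) ≠ ∞)).ne'
  -- Weights whose inverses sum to 1: a sum of increments is then at most the supremum of the
  -- weighted increments.
  let c : ℕ → ℝ≥0∞ := fun i => 2 ^ (i + 1)
  have hc0 : ∀ i, c i ≠ 0 := fun i => pow_ne_zero _ two_ne_zero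
  have hct : ∀ i, c i ≠ ∞ := fun i => ENNReal.pow_ne_top (by simp)
  have hcp0 : ∀ i, c i ^ p ≠ 0 := fun i => by simp [ENNReal.rpow_eq_zero_iff, hc0, hct]
  have hcpt : ∀ i, c i ^ p ≠ ∞ := fun i => ENNReal.rpow_ne_top_of_nonneg hp0.le (hct i)
  have hcsum : ∑' i, (c i)⁻¹ = 1 := by
    have := ENNReal.tsum_geometric_add_one 2⁻¹
    simp only [c, ENNReal.inv_pow]
    rw [this, ENNReal.one_sub_inv_two, inv_inv, ENNReal.inv_mul_cancel two_ne_zero (by simp)]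
  -- The increments are made small enough to absorb the factor (c i)^p and still leave the summable
  -- bound B / c i.
  obtain ⟨φ, hφ, hφ'⟩ := extraction_forall_of_eventually'
    (P := fun i n => ∀ m ≥ n, ∫⁻ z, (f m z - f n z) ^ p ∂μ ≤ (c i ^ p)⁻¹ * (B * (c i)⁻¹))
    (fun i => exists_forall_lintegral_sub_rpow_le hp hΓ hB0 hB hmod hf hint
      (mul_ne_zero (ENNReal.inv_ne_zero.2 (hcpt i))
        (mul_ne_zero hB0 (ENNReal.inv_ne_zero.2 (hct i)))))
  let g : ℕ → Z → ℝ≥0∞ := fun i z => f (φ (i + 1)) z - f (φ i) z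
  have hgm : ∀ i, Measurable (g i) := fun i => (hf _).1.sub (hf _).1
  have hg : ∀ i, ∫⁻ z, (c i * g i z) ^ p ∂μ ≤ B * (c i)⁻¹ := by
    intro i
    simp only [ENNReal.mul_rpow_of_nonneg _ _ hp0.le]
    rw [lintegral_const_mul' _ _ (hcpt i)]
    refine (mul_le_mul_right (hφ' i _ (hφ i.lt_succ_self).le) _).trans_eq ?_
    rw [← mul_assoc, ENNReal.mul_inv_cancel (hcp0 i) (hcpt i), one_mul]
  let ρ : Z → ℝ≥0∞ := fun z => ⨆ i, f (φ i) z
  have hρm : Measurable ρ := .iSup fun i => (hf _).1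
  have hadm : ModAdmissible (⋃ n, Γ n) ρ := by
    refine ⟨hρm, fun γ hγ hr => ?_⟩
    obtain ⟨n, hn⟩ := mem_iUnion.1 hγ
    exact ((hf (φ n)).2 γ (hΓ (hφ.id_le n) hn) hr).trans
      (pathIntegral_mono fun z => le_iSup (fun i => f (φ i) z) n)
  -- Telescoping survives truncated subtraction as an inequality.
  have hsum : ∀ n z, f (φ n) z ≤ f (φ 0) z + ∑ i ∈ Finset.range n, g i z := by
    intro n z
    induction n with
    | zero => simp
    | succ n ih =>
      rw [Finset.sum_range_succ, ← add_assoc]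
      exact le_add_tsub.trans (add_le_add ih le_rfl)
  have hle : ∀ z, ρ z ≤ f (φ 0) z + ⨆ i, c i * g i z := by
    refine fun z => iSup_le fun n => (hsum n z).trans ?_
    gcongr
    calc ∑ i ∈ Finset.range n, g i z ≤ ∑ i ∈ Finset.range n, (c i)⁻¹ * ⨆ i, c i * g i z := by
          refine Finset.sum_le_sum fun i _ => ?_
          calc g i z = (c i)⁻¹ * (c i * g i z) := by
                rw [← mul_assoc, ENNReal.inv_mul_cancel (hc0 i) (hct i), one_mul]
            _ ≤ _ := by
              gcongr
              exact le_iSup (fun i => c i * g i z) i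
      _ = (∑ i ∈ Finset.range n, (c i)⁻¹) * ⨆ i, c i * g i z := (Finset.sum_mul ..).symm
      _ ≤ 1 * ⨆ i, c i * g i z := by
          gcongr
          exact (ENNReal.sum_le_tsum _).trans_eq hcsum
      _ = _ := one_mul _
  have hpow : ∀ z, ρ z ^ p ≤ 2 ^ p * (f (φ 0) z ^ p + ∑' i, (c i * g i z) ^ p) := by
    intro z
    calc ρ z ^ p ≤ (f (φ 0) z + ⨆ i, c i * g i z) ^ p := by gcongr; exact hle z
      _ ≤ 2 ^ (p - 1) * (f (φ 0) z ^ p + (⨆ i, c i * g i z) ^ p) :=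
        ENNReal.rpow_add_le_mul_rpow_add_rpow _ _ hp.le
      _ ≤ 2 ^ p * (f (φ 0) z ^ p + ∑' i, (c i * g i z) ^ p) := by
        gcongr
        · norm_num
        · linarith
        · rw [← ENNReal.le_rpow_inv_iff hp0]
          refine iSup_le fun i => ?_
          rw [ENNReal.le_rpow_inv_iff hp0]
          exact ENNReal.le_tsum i
  calc modulus μ p (⋃ n, Γ n) ≤ ∫⁻ z, ρ z ^ p ∂μ := iInf₂_le ρ hadm
    _ ≤ ∫⁻ z, 2 ^ p * (f (φ 0) z ^ p + ∑' i, (c i * g i z) ^ p) ∂μ := lintegral_mono hpow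
    _ = 2 ^ p * (∫⁻ z, f (φ 0) z ^ p ∂μ + ∑' i, ∫⁻ z, (c i * g i z) ^ p ∂μ) := by
      rw [lintegral_const_mul' _ _ (ENNReal.rpow_ne_top_of_nonneg hp0.le (by simp)),
        lintegral_add_left ((hf _).1.pow_const p), lintegral_tsum]
      exact fun i => (((hgm i).const_mul _).pow_const p).aemeasurable
    _ ≤ 2 ^ p * ((B + B) + ∑' i, B * (c i)⁻¹) := by
      gcongr with i
      · refine (hint _).trans (add_le_add (hmod _) ?_)
        exact ENNReal.div_le_of_le_mul (le_mul_of_one_le_right' (by simp))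
      · exact hg i
    _ = 2 ^ p * (3 * B) := by
      rw [ENNReal.tsum_mul_left, hcsum, mul_one]
      ring

end Modulus

/-! ### Geometry of hyperbolic fillings -/

namespace HyperbolicFilling

variable {Z : Type u} [MetricSpace Z] {s : ℝ}

/-- The separation of the centers of level `k`; the balls of level `k` have twice this radius. -/
def radius (F : HyperbolicFilling Z s) (k : ℕ) : ℝ :=
  F.scale * s ^ (-(k : ℤ))

lemma scale_pos (F : HyperbolicFilling Z s) : 0 < F.scale :=
  Metric.diam_nonneg.trans_lt F.diam_lt_scale

lemma radius_eq (F : HyperbolicFilling Z s) (k : ℕ) : F.radius k = F.scale / s ^ k := by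
  rw [radius, zpow_neg, zpow_natCast, div_eq_mul_inv]

lemma radius_pos (F : HyperbolicFilling Z s) (hs : 1 < s) (k : ℕ) : 0 < F.radius k :=
  mul_pos F.scale_pos (zpow_pos (by linarith) _)

lemma tendsto_radius (F : HyperbolicFilling Z s) (hs : 1 < s) :
    Tendsto F.radius atTop (𝓝 0) := by
  simp only [funext F.radius_eq]
  exact (tendsto_pow_atTop_atTop_of_one_lt hs).const_div_atTop _

lemma antitone_radius (F : HyperbolicFilling Z s) (hs : 1 < s) : Antitone F.radius := by
  intro i j hij
  rw [radius_eq, radius_eq]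
  exact div_le_div_of_nonneg_left F.scale_pos.le (pow_pos (by linarith) _)
    (pow_le_pow_right₀ hs.le hij)

lemma ball_eq (F : HyperbolicFilling Z s) (v : F.Vertex) :
    F.ball v = Metric.ball (F.center v) (2 * F.radius (F.level v)) := rfl

lemma radius_le_dist (F : HyperbolicFilling Z s) {k : ℕ} {x y : Z} (hx : x ∈ F.P k)
    (hy : y ∈ F.P k) (hxy : x ≠ y) : F.radius k ≤ dist x y :=
  (F.maximal_separated k).1 hx hy hxy

/-- A point at distance at least the radius from all centers could be added to them, against
maximality. -/
lemma exists_dist_lt_radius (F : HyperbolicFilling Z s) (hs : 1 < s) (k : ℕ) (z : Z) :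
    ∃ x ∈ F.P k, dist z x < F.radius k := by
  by_contra! h
  have hins : (insert z (F.P k)).Pairwise fun x y => F.scale * s ^ (-(k : ℤ)) ≤ dist x y :=
    (F.maximal_separated k).1.insert fun y hy _ => ⟨h y hy, by rw [dist_comm]; exact h y hy⟩
  have hz : z ∈ F.P k :=
    (F.maximal_separated k).2 hins (subset_insert _ _) (mem_insert _ _)
  have := h z hz
  rw [dist_self] at this
  exact absurd (F.radius_pos hs k) (not_lt.2 this)

/-- A ball of half the separation radius contains at most one center, and finitely many such balls
cover Z. -/
lemma finite_P [CompactSpace Z] (F : HyperbolicFilling Z s) (hs : 1 < s) (k : ℕ) :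
    (F.P k).Finite := by
  have hr := F.radius_pos hs k
  obtain ⟨t, -, ht, hcov⟩ := (isCompact_univ (X := Z)).finite_cover_balls (half_pos hr)
  choose! c hc hzc using fun z : Z => mem_iUnion₂.1 (hcov (mem_univ z))
  refine Set.Finite.of_injOn (f := c) (fun x _ => hc x) (fun x hx y hy hxy => ?_) ht
  by_contra hne
  have h1 := F.radius_le_dist hx hy hne
  have h2 : dist x (c x) < F.radius k / 2 := hzc x
  have h3 : dist y (c x) < F.radius k / 2 := hxy ▸ hzc y
  linarith [dist_triangle_right x y (c x)]

/-- The vertices of a given level. -/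
def vertices (F : HyperbolicFilling Z s) (k : ℕ) : Set F.Vertex := {v | F.level v = k}

lemma exists_vertex_dist_lt (F : HyperbolicFilling Z s) (hs : 1 < s) (k : ℕ) (z : Z) :
    ∃ v ∈ F.vertices k, dist z (F.center v) < F.radius k := by
  obtain ⟨x, hx, hzx⟩ := F.exists_dist_lt_radius hs k z
  exact ⟨(⟨k, x, hx⟩ : Σ k, F.P k), rfl, hzx⟩

lemma finite_vertices [CompactSpace Z] (F : HyperbolicFilling Z s) (hs : 1 < s) (k : ℕ) :
    (F.vertices k).Finite := by
  have := (F.finite_P hs k).to_subtype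
  refine (Set.finite_range fun x : F.P k => (⟨k, x⟩ : F.Vertex)).subset ?_
  rintro ⟨j, x⟩ (rfl : j = k)
  exact ⟨x, rfl⟩

lemma finite_level_lt [CompactSpace Z] (F : HyperbolicFilling Z s) (hs : 1 < s) (k : ℕ) :
    {v : F.Vertex | F.level v < k}.Finite := by
  refine ((Set.finite_Iio k).biUnion fun j _ => F.finite_vertices hs j).subset fun v hv => ?_
  exact mem_biUnion (show F.level v ∈ Iio k from hv) rfl

lemma countable_vertex [CompactSpace Z] (F : HyperbolicFilling Z s) (hs : 1 < s) :
    Countable F.Vertex := by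
  have : ∀ k, Countable (F.P k) := fun k => (F.finite_P hs k).countable.to_subtype
  exact inferInstanceAs (Countable (Σ k, F.P k))

lemma IsExpandingCovers.eventually_le_level [CompactSpace Z] {F : HyperbolicFilling Z s}
    (hs : 1 < s) {S : ℕ → Set F.Vertex} (hS : F.IsExpandingCovers S) (k : ℕ) :
    ∀ᶠ n in atTop, ∀ v ∈ S n, k ≤ F.level v := by
  filter_upwards [hS.expanding _ (F.finite_level_lt hs k)] with n hn v hv
  by_contra! h
  exact (Set.ext_iff.1 hn v).1 ⟨hv, h⟩

/-- Full levels are the only covers against which admissibility is tested in the lower bound; the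
freedom to choose `l` permits keeping only levels of small energy. -/
lemma isExpandingCovers_vertices [CompactSpace Z] (F : HyperbolicFilling Z s) (hs : 1 < s)
    {l : ℕ → ℕ} (hl : Tendsto l atTop atTop) : F.IsExpandingCovers fun n => F.vertices (l n) where
  finite n := F.finite_vertices hs _
  covers n := by
    refine eq_univ_of_forall fun z => ?_
    obtain ⟨v, hv, hzv⟩ := F.exists_vertex_dist_lt hs (l n) z
    refine mem_biUnion hv ?_
    rw [ball_eq, Metric.mem_ball, show F.level v = l n from hv]
    linarith [F.radius_pos hs (l n)]
  expanding A hA := by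
    obtain ⟨N, hN⟩ := (hA.image F.level).bddAbove
    filter_upwards [hl.eventually_gt_atTop N] with n hn
    refine eq_empty_of_forall_notMem fun v hv => ?_
    have h1 : F.level v = l n := hv.1
    have h2 := hN (mem_image_of_mem _ hv.2)
    omega

end HyperbolicFilling

/-! ### Consequences of Ahlfors regularity -/

section Ahlfors

variable {Z : Type u} [MetricSpace Z] [MeasurableSpace Z] {μ : Measure Z} {Q a b s : ℝ}

lemma IsAhlforsRegular.isFiniteMeasure [CompactSpace Z] (h : IsAhlforsRegular μ Q a b)
    (hd : 0 < Metric.diam (univ : Set Z)) : IsFiniteMeasure μ := by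
  obtain ⟨t, -, ht, hcov⟩ := (isCompact_univ (X := Z)).finite_cover_balls hd
  refine ⟨(measure_mono hcov).trans_lt ((measure_biUnion_lt_top ht fun x _ => ?_))⟩
  exact ((h.2.2 x _ hd le_rfl).2).trans_lt ENNReal.ofReal_lt_top

variable [CompactSpace Z] [BorelSpace Z]

/-- Separated centers have disjoint balls, whence a bound on their number. -/
lemma IsAhlforsRegular.encard_mul_le (h : IsAhlforsRegular μ Q a b) (hs : 1 < s)
    (F : HyperbolicFilling Z s) {k : ℕ} (hk : F.radius k ≤ Metric.diam (univ : Set Z))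
    (T : Set (F.P k)) {U : Set Z}
    (hU : ∀ x ∈ T, Metric.ball (x : Z) (F.radius k / 2) ⊆ U) :
    (T.encard : ℝ≥0∞) * ENNReal.ofReal (a * (F.radius k / 2) ^ Q) ≤ μ U := by
  have hr := F.radius_pos hs k
  have : Countable (F.P k) := (F.finite_P hs k).countable.to_subtype
  rw [← ENNReal.tsum_set_const]
  calc ∑' _ : T, ENNReal.ofReal (a * (F.radius k / 2) ^ Q)
      ≤ ∑' x : T, μ (Metric.ball (x : Z) (F.radius k / 2)) :=
        ENNReal.tsum_le_tsum fun x => (h.2.2 _ _ (half_pos hr) (by linarith)).1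
    _ = μ (⋃ x : T, Metric.ball (x : Z) (F.radius k / 2)) := by
        refine (measure_iUnion (fun x y hxy => ?_) fun x => Metric.isOpen_ball.measurableSet).symm
        refine Metric.ball_disjoint_ball ?_
        have hne : ((x : F.P k) : Z) ≠ (y : F.P k) := fun he => hxy (Subtype.ext (Subtype.ext he))
        linarith [F.radius_le_dist x.1.2 y.1.2 hne]
    _ ≤ μ U := measure_mono (iUnion_subset fun x => hU _ x.2)

/-- The balls of a level of small scale have bounded overlap. -/
lemma IsAhlforsRegular.encard_mem_ball_le (h : IsAhlforsRegular μ Q a b) (hs : 1 < s)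
    (F : HyperbolicFilling Z s) {k : ℕ} (hk : 3 * F.radius k ≤ Metric.diam (univ : Set Z)) (z : Z) :
    ({x : F.P k | z ∈ Metric.ball (x : Z) (2 * F.radius k)}.encard : ℝ≥0∞) ≤
      ENNReal.ofReal (b / a * 6 ^ Q) := by
  have hr := F.radius_pos hs k
  have ha := h.1
  have key := h.encard_mul_le hs F (by linarith)
    {x : F.P k | z ∈ Metric.ball (x : Z) (2 * F.radius k)}
    (U := Metric.ball z (3 * F.radius k)) fun x hx => by
      refine Metric.ball_subset_ball' ?_
      have : dist z x < 2 * F.radius k := hx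
      rw [dist_comm]
      linarith
  have hpos : 0 < a * (F.radius k / 2) ^ Q :=
    mul_pos ha (Real.rpow_pos_of_pos (by linarith) _)
  have hmul := key.trans (h.2.2 z _ (by linarith) hk).2
  rw [← ENNReal.le_div_iff_mul_le (Or.inl (ENNReal.ofReal_pos.2 hpos).ne')
    (Or.inl ENNReal.ofReal_ne_top), ← ENNReal.ofReal_div_of_pos hpos] at hmul
  refine hmul.trans_eq ?_
  congr 1
  rw [show 3 * F.radius k = 6 * (F.radius k / 2) by ring,
    Real.mul_rpow (by norm_num) (by linarith)]
  have : (F.radius k / 2) ^ Q ≠ 0 := (Real.rpow_pos_of_pos (by linarith) _).ne'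
  field_simp

/-- The number of vertices grows at most like `s ^ (k * Q)`. -/
lemma IsAhlforsRegular.exists_encard_vertices_le (h : IsAhlforsRegular μ Q a b) (hs : 1 < s)
    (hd : 0 < Metric.diam (univ : Set Z)) (F : HyperbolicFilling Z s) :
    ∃ A : ℝ≥0, ∀ k, F.radius k ≤ Metric.diam (univ : Set Z) →
      ((F.vertices k).encard : ℝ≥0∞) ≤ A * ENNReal.ofReal (s ^ Q) ^ k := by
  have := h.isFiniteMeasure hd
  have hs0 : 0 < s := by linarith
  have hc : 0 < a * (F.scale / 2) ^ Q :=
    mul_pos h.1 (Real.rpow_pos_of_pos (by linarith [F.scale_pos]) _)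
  -- This constant depends on the total mass and the scale. It will only influence how far out a
  -- level is chosen, not the final constants.
  refine ⟨(μ univ / ENNReal.ofReal (a * (F.scale / 2) ^ Q)).toNNReal, fun k hk => ?_⟩
  rw [ENNReal.coe_toNNReal (ENNReal.div_ne_top (measure_ne_top _ _) (ENNReal.ofReal_pos.2 hc).ne')]
  have hle : (F.vertices k).encard ≤ (univ : Set (F.P k)).encard := by
    rw [← Set.InjOn.encard_image (f := fun x : F.P k => (⟨k, x⟩ : F.Vertex))]
    · refine Set.encard_le_encard ?_
      rintro ⟨j, x⟩ (rfl : j = k)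
      exact ⟨x, mem_univ _, rfl⟩
    · intro x _ y _ hxy
      simpa using hxy
  refine (ENat.toENNReal_mono hle).trans ?_
  have key := h.encard_mul_le hs F hk univ (U := univ) fun _ _ => subset_univ _
  have hpow : a * (F.radius k / 2) ^ Q = a * (F.scale / 2) ^ Q / (s ^ Q) ^ k := by
    rw [F.radius_eq, div_right_comm, Real.div_rpow (by linarith [F.scale_pos]) (by positivity),
      ← Real.rpow_natCast s k, ← Real.rpow_mul hs0.le, mul_comm (k : ℝ), Real.rpow_mul hs0.le,
      Real.rpow_natCast, mul_div_assoc]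
  have hsk : 0 < (s ^ Q) ^ k := by positivity
  rw [hpow, ENNReal.ofReal_div_of_pos hsk, ENNReal.ofReal_pow (by positivity), ← mul_div_assoc] at key
  have hsk' : ENNReal.ofReal (s ^ Q) ^ k ≠ 0 :=
    pow_ne_zero _ (ENNReal.ofReal_pos.2 (by positivity)).ne'
  rw [ENNReal.div_le_iff hsk' (ENNReal.pow_ne_top ENNReal.ofReal_ne_top),
    ← ENNReal.le_div_iff_mul_le (Or.inl (ENNReal.ofReal_pos.2 hc).ne')
      (Or.inl ENNReal.ofReal_ne_top)] at key
  refine key.trans_eq ?_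
  rw [ENNReal.mul_div_right_comm]

end Ahlfors

/-- The sum of the members below `X` of a geometric progression is at most a multiple of `X`. -/
lemma tsum_geometric_lt_le {c q G : ℝ≥0∞} (hG1 : 1 ≤ G) (hG : G + q ≤ G * q) (X : ℝ≥0∞) :
    ∑' k : ℕ, (if c * q ^ k < X then c * q ^ k else 0) ≤ G * X := by
  -- For finite q > 1, `hG` says G ≥ q / (q - 1) without subtraction; it is exactly the induction
  -- step.
  have hsum : ∀ n, ∑ k ∈ Finset.range (n + 1), c * q ^ k ≤ G * (c * q ^ n) := by
    intro n
    induction n with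
    | zero => simpa using le_mul_of_one_le_left' hG1
    | succ n ih =>
      rw [Finset.sum_range_succ]
      calc _ ≤ G * (c * q ^ n) + c * q ^ (n + 1) := by gcongr
        _ = (G + q) * (c * q ^ n) := by ring
        _ ≤ G * q * (c * q ^ n) := by gcongr
        _ = _ := by ring
  refine ENNReal.tsum_le_of_sum_range_le fun n => ?_
  -- Trailing terms that fail the cutoff are discarded until the last term is below X; then the
  -- whole partial sum is at most G times that term.
  induction n with
  | zero => simp
  | succ n ih =>
    by_cases hn : c * q ^ n < X
    · calc _ ≤ ∑ k ∈ Finset.range (n + 1), c * q ^ k :=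
            Finset.sum_le_sum fun k _ => by split_ifs <;> simp
        _ ≤ G * (c * q ^ n) := hsum n
        _ ≤ G * X := by gcongr
    · rw [Finset.sum_range_succ, if_neg hn, add_zero]
      exact ih

/-! ### The capacity is bounded by the modulus -/

section InfBall

variable {Z : Type u} [MetricSpace Z]

/-- An increasing approximation of a lower semicontinuous function by bounded functions that are
infima over small balls. -/
def infApprox (ρ : Z → ℝ≥0∞) (i : ℕ) (x : Z) : ℝ≥0∞ :=
  min (i : ℝ≥0∞) (⨅ y ∈ Metric.ball x (1 / ((i : ℝ) + 1)), ρ y)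

/-- An infimum over open balls of fixed radius is upper semicontinuous in the center, for any ρ. -/
lemma measurable_infApprox [MeasurableSpace Z] [BorelSpace Z] (ρ : Z → ℝ≥0∞) (i : ℕ) :
    Measurable (infApprox ρ i) := by
  refine measurable_const.min (UpperSemicontinuous.measurable fun x c hc => ?_)
  simp only [iInf_lt_iff, Metric.mem_ball] at hc ⊢
  obtain ⟨y, hy, hyc⟩ := hc
  have : ∀ᶠ x' in 𝓝 x, dist y x' < 1 / ((i : ℝ) + 1) :=
    (continuous_const.dist continuous_id).continuousAt.eventually_lt continuousAt_const hy
  filter_upwards [this] with x' hx' using ⟨y, hx', hyc⟩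

lemma monotone_infApprox (ρ : Z → ℝ≥0∞) : Monotone (infApprox ρ) := by
  intro i j hij x
  refine min_le_min (by exact_mod_cast hij) (biInf_mono fun y hy => ?_)
  exact Metric.ball_subset_ball (one_div_le_one_div_of_le (by positivity) (by gcongr)) hy

lemma iSup_infApprox {ρ : Z → ℝ≥0∞} (hρ : LowerSemicontinuous ρ) (x : Z) :
    ⨆ i, infApprox ρ i x = ρ x := by
  refine le_antisymm (iSup_le fun i => (min_le_right _ _).trans
    (iInf₂_le x (Metric.mem_ball_self Nat.one_div_pos_of_nat)))
    (le_of_forall_lt_imp_le_of_dense fun c hc => ?_)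
  obtain ⟨ε, hε, hball⟩ := Metric.eventually_nhds_iff_ball.1 (hρ x c hc)
  obtain ⟨n, hn⟩ := exists_nat_one_div_lt hε
  obtain ⟨m, hm⟩ := ENNReal.exists_nat_gt hc.ne_top
  refine le_trans ?_ (le_iSup (fun i => infApprox ρ i x) (max n m))
  refine le_min (hm.le.trans (by exact_mod_cast le_max_right n m)) (le_iInf₂ fun y hy => ?_)
  refine (hball y (Metric.ball_subset_ball ?_ hy)).le
  refine (one_div_le_one_div_of_le (by positivity) ?_).trans hn.le
  gcongr
  exact le_max_left n m

lemma IsRectifiable.iSup_pathIntegral_infApprox [MeasurableSpace Z] [BorelSpace Z] {γ : C(I, Z)}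
    (h : IsRectifiable γ) {ρ : Z → ℝ≥0∞} (hρ : LowerSemicontinuous ρ) :
    ⨆ i, pathIntegral (infApprox ρ i) γ = pathIntegral ρ γ := by
  simp only [pathIntegral]
  rw [← lintegral_iSup']
  · simp only [iSup_infApprox hρ]
  · exact fun i => (measurable_infApprox ρ i).comp_aemeasurable
      (h.continuousOn_naturalParameterization.aemeasurable measurableSet_Icc)
  · exact ae_of_all _ fun t i j hij => monotone_infApprox ρ hij _

lemma pathIntegral_eq_zero_of_pathLength {γ : C(I, Z)} (h : pathLength γ = 0) (ρ : Z → ℝ≥0∞) :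
    pathIntegral ρ γ = 0 := by
  simp [pathIntegral, h]

end InfBall

/-! ### Admissibility of the infimum weights -/

namespace HyperbolicFilling

variable {Z : Type u} [MetricSpace Z] {s : ℝ} {F : HyperbolicFilling Z s}

lemma Projection.exists_seq {γ : C(I, Z)} {S : Set F.Vertex} (P : F.Projection γ S) :
    ∃ (t : ℕ → I) (v : ℕ → F.Vertex), Monotone t ∧ t 0 = 0 ∧ t P.m = 1 ∧
      (∀ k < P.m, v k ∈ S) ∧ (∀ k < P.m, ∀ x ∈ Icc (t k) (t (k + 1)), γ x ∈ F.ball (v k)) ∧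
      ∀ τ : F.Vertex → ℝ≥0∞, P.tauLength τ = ∑ k ∈ Finset.range P.m, τ (v k) := by
  have hm : 0 < P.m := by
    by_contra! h
    have h0 : P.m = 0 := by omega
    have : Fin.last P.m = 0 := Fin.ext (by simp [h0])
    have h1 := P.t_last
    rw [this, P.t_zero] at h1
    exact zero_ne_one h1
  -- Partition points are clamped at the last index and surplus vertices get a default value, so
  -- that sums over `Finset.range` apply; the default needs at least one piece.
  let t : ℕ → I := fun i => P.t ⟨min i P.m, by omega⟩
  let v : ℕ → F.Vertex := fun i => if h : i < P.m then P.v ⟨i, h⟩ else P.v ⟨0, hm⟩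
  refine ⟨t, v, fun i j hij => P.strictMono.monotone ?_, ?_, ?_, ?_, ?_, ?_⟩
  · exact Fin.mk_le_mk.2 (by omega)
  · simp only [t, Nat.zero_min]
    exact P.t_zero
  · simp only [t, min_self]
    exact P.t_last
  · intro k hk
    simp only [v, hk, dif_pos]
    exact P.v_mem _
  · intro k hk x hx
    simp only [v, hk, dif_pos]
    refine P.image_subset ⟨k, hk⟩ (mem_image_of_mem _ ?_)
    convert hx using 2
    · simp only [t]
      congr 1
      exact Fin.ext (by simp [hk.le])
    · simp only [t]
      congr 1
      exact Fin.ext (by simp [Nat.succ_le_of_lt hk])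
  · intro τ
    rw [Projection.tauLength, ← Fin.sum_univ_eq_sum_range (fun k => τ (v k))]
    exact Finset.sum_congr rfl fun k _ => by simp [v]

lemma dist_lt_of_mem_ball (F : HyperbolicFilling Z s) {v : F.Vertex} {x y : Z} (hx : x ∈ F.ball v)
    (hy : y ∈ F.ball v) : dist x y < 4 * F.radius (F.level v) := by
  rw [ball_eq, Metric.mem_ball] at hx hy
  linarith [dist_triangle_right x y (F.center v)]

/-- The weight `v ↦ 4 r_v inf_{B_v} ρ`, up to changes on finitely many levels, is admissible for
the paths on which `ρ` has integral at least one. -/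
lemma admissible_of_lowerSemicontinuous [CompactSpace Z] [MeasurableSpace Z] [BorelSpace Z]
    (hs : 1 < s) {γ : C(I, Z)} {ρ : Z → ℝ≥0∞} (hρ : LowerSemicontinuous ρ) {δ : ℝ≥0∞}
    (hδ : δ ≠ 0) (hδ' : δ ≠ ∞) (hδρ : ∀ z, δ ≤ ρ z)
    (hγ : IsRectifiable γ → 1 ≤ pathIntegral ρ γ) {τ : F.Vertex → ℝ≥0∞} {k₀ : ℕ}
    (hτ : ∀ v, k₀ ≤ F.level v →
      τ v = ENNReal.ofReal (4 * F.radius (F.level v)) * ⨅ x ∈ F.ball v, ρ x) :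
    F.Admissible τ γ := by
  intro S hS
  have hsmall : ∀ ε : ℝ, 0 < ε →
      ∀ᶠ n in atTop, ∀ v ∈ S n, k₀ ≤ F.level v ∧ 4 * F.radius (F.level v) ≤ ε := by
    intro ε hε
    obtain ⟨k, hk⟩ := ((F.tendsto_radius hs).eventually_le_const
      (show (0 : ℝ) < ε / 4 by positivity)).exists
    filter_upwards [hS.eventually_le_level hs (max k₀ k)] with n hn v hv
    have h1 := hn v hv
    refine ⟨(le_max_left _ _).trans h1, ?_⟩
    linarith [F.antitone_radius hs ((le_max_right _ _).trans h1)]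
  -- The factor 4 in τ is used here: 4 r_v bounds the distance of any two points of B_v.
  have hchord : ∀ v, k₀ ≤ F.level v → ∀ x ∈ F.ball v, ∀ y ∈ F.ball v,
      (⨅ z ∈ F.ball v, ρ z) * edist x y ≤ τ v := by
    intro v hv x hx y hy
    rw [hτ v hv, mul_comm, edist_dist]
    gcongr
    exact (F.dist_lt_of_mem_ball hx hy).le
  by_cases hr : IsRectifiable γ
  · refine le_of_forall_lt_imp_le_of_dense fun M hM => ?_
    have hM' := hM.trans_le (hγ hr)
    rw [← hr.iSup_pathIntegral_infApprox hρ] at hM'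
    obtain ⟨i, hi⟩ := lt_iSup_iff.1 hM'
    obtain ⟨r, hr0, hrM⟩ := ENNReal.lt_iff_exists_add_pos_lt.1 hi
    -- The truncated density is at most i, so replacing lengths by chords with total defect η costs
    -- at most i η < r.
    obtain ⟨η, hη, hηr⟩ := ENNReal.exists_nnreal_pos_mul_lt (ENNReal.natCast_ne_top i)
      (ENNReal.coe_ne_zero.2 hr0.ne')
    have hlen : pathLength γ ≠ 0 := fun h0 => by
      have := hγ hr
      rw [pathIntegral_eq_zero_of_pathLength h0] at this
      simp at this
    obtain ⟨ε, hε, hεsum⟩ := exists_lt_sum_edist γ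
      (ENNReal.sub_lt_self hr hlen (ENNReal.coe_ne_zero.2 hη.ne'))
    refine le_liminf_of_le (by isBoundedDefault) ?_
    filter_upwards [hsmall (min ε (1 / ((i : ℝ) + 1)))
      (lt_min hε Nat.one_div_pos_of_nat)] with n hn
    refine le_iInf fun P => ?_
    obtain ⟨t, v, ht, h0, h1, hvS, hball, hsum⟩ := P.exists_seq
    rw [hsum]
    have hosc : ∀ k < P.m, ∀ x ∈ Icc (t k) (t (k + 1)), dist (γ (t k)) (γ x) ≤ ε :=
      fun k hk x hx => ((F.dist_lt_of_mem_ball (hball k hk _ ⟨le_rfl, ht k.le_succ⟩)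
        (hball k hk x hx)).le.trans (hn _ (hvS k hk)).2).trans (min_le_left _ _)
    have hchords := hεsum t P.m ht h0 h1 hosc
    set L : ℕ → ℝ≥0∞ := fun k => eVariationOn γ (Icc (t k) (t (k + 1))) with hL
    set D : ℕ → ℝ≥0∞ := fun k => edist (γ (t k)) (γ (t (k + 1))) with hD
    have hDL : ∀ k, D k ≤ L k := fun k =>
      eVariationOn.edist_le _ ⟨le_rfl, ht k.le_succ⟩ ⟨ht k.le_succ, le_rfl⟩
    have hLsum : ∑ k ∈ Finset.range P.m, L k = pathLength γ := sum_eVariationOn_Icc γ ht h0 h1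
    have hdefect : ∑ k ∈ Finset.range P.m, (L k - D k) ≤ η := by
      have hfin : ∑ k ∈ Finset.range P.m, D k ≠ ∞ :=
        ((Finset.sum_le_sum fun k _ => hDL k).trans_lt (hLsum ▸ hr.lt_top)).ne
      refine (ENNReal.add_le_add_iff_right hfin).1 ?_
      rw [← Finset.sum_add_distrib]
      simp only [tsub_add_cancel_of_le (hDL _)]
      rw [hLsum]
      exact (tsub_le_iff_left.1 hchords.le)
    -- The balls are now so small that each lies in the ball of radius 1/(i + 1) about any of its
    -- points.
    have hint : pathIntegral (infApprox ρ i) γ ≤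
        ∑ k ∈ Finset.range P.m, min (i : ℝ≥0∞) (⨅ z ∈ F.ball (v k), ρ z) * L k := by
      refine hr.pathIntegral_le_sum ht h0 h1 fun k hk x hx => min_le_min le_rfl ?_
      refine biInf_mono fun y hy => ?_
      exact ((F.dist_lt_of_mem_ball hy (hball k hk x hx)).trans_le
        (hn _ (hvS k hk)).2).trans_le (min_le_right _ _)
    have hfinal : pathIntegral (infApprox ρ i) γ ≤
        ∑ k ∈ Finset.range P.m, τ (v k) + r := by
      calc _ ≤ ∑ k ∈ Finset.range P.m, (τ (v k) + i * (L k - D k)) := by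
            refine hint.trans (Finset.sum_le_sum fun k hk => ?_)
            have hk := Finset.mem_range.1 hk
            calc min (i : ℝ≥0∞) (⨅ z ∈ F.ball (v k), ρ z) * L k
                = min (i : ℝ≥0∞) (⨅ z ∈ F.ball (v k), ρ z) * D k +
                  min (i : ℝ≥0∞) (⨅ z ∈ F.ball (v k), ρ z) * (L k - D k) := by
                  rw [← mul_add, add_tsub_cancel_of_le (hDL k)]
              _ ≤ (⨅ z ∈ F.ball (v k), ρ z) * D k + i * (L k - D k) := by
                  gcongr
                  · exact min_le_right _ _
                  · exact min_le_left _ _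
              _ ≤ _ := by
                  gcongr
                  exact hchord _ (hn _ (hvS k hk)).1 _ (hball k hk _ ⟨le_rfl, ht k.le_succ⟩) _
                    (hball k hk _ ⟨ht k.le_succ, le_rfl⟩)
        _ = ∑ k ∈ Finset.range P.m, τ (v k) + i * ∑ k ∈ Finset.range P.m, (L k - D k) := by
            rw [Finset.sum_add_distrib, Finset.mul_sum]
        _ ≤ _ := by
            gcongr
            refine le_trans ?_ hηr.le
            rw [mul_comm]
            gcongr
    exact (ENNReal.add_le_add_iff_right ENNReal.coe_ne_top).1 (hrM.le.trans hfinal)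
  · have htop : pathLength γ = ∞ := not_not.1 hr
    -- Infinite length gives chord sums above 1/δ, and the density is at least δ.
    obtain ⟨ε, hε, hεsum⟩ := exists_lt_sum_edist γ (M := δ⁻¹)
      (by rw [htop]; exact (ENNReal.inv_ne_top.2 hδ).lt_top)
    refine le_liminf_of_le (by isBoundedDefault) ?_
    filter_upwards [hsmall ε hε] with n hn
    refine le_iInf fun P => ?_
    obtain ⟨t, v, ht, h0, h1, hvS, hball, hsum⟩ := P.exists_seq
    rw [hsum]
    have hosc : ∀ k < P.m, ∀ x ∈ Icc (t k) (t (k + 1)), dist (γ (t k)) (γ x) ≤ ε :=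
      fun k hk x hx => (F.dist_lt_of_mem_ball (hball k hk _ ⟨le_rfl, ht k.le_succ⟩)
        (hball k hk x hx)).le.trans (hn _ (hvS k hk)).2
    calc (1 : ℝ≥0∞) = δ * δ⁻¹ := (ENNReal.mul_inv_cancel hδ hδ').symm
      _ ≤ δ * ∑ k ∈ Finset.range P.m, edist (γ (t k)) (γ (t (k + 1))) := by
          gcongr
          exact (hεsum t P.m ht h0 h1 hosc).le
      _ = ∑ k ∈ Finset.range P.m, δ * edist (γ (t k)) (γ (t (k + 1))) := Finset.mul_sum ..
      _ ≤ ∑ k ∈ Finset.range P.m, τ (v k) := by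
          refine Finset.sum_le_sum fun k hk => ?_
          have hk := Finset.mem_range.1 hk
          refine le_trans ?_ (hchord _ (hn _ (hvS k hk)).1 _
            (hball k hk _ ⟨le_rfl, ht k.le_succ⟩) _ (hball k hk _ ⟨ht k.le_succ, le_rfl⟩))
          gcongr
          exact le_iInf₂ fun z _ => hδρ z

end HyperbolicFilling

/-! ### Weak-type counting of vertices -/

section Counting

variable {Z : Type u} [MetricSpace Z] [CompactSpace Z] [MeasurableSpace Z] [BorelSpace Z]
  {μ : Measure Z} {Q a b s : ℝ}

/-- Puts the inverse scales in the form c q^k required by `tsum_geometric_lt_le`. -/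
lemma HyperbolicFilling.inv_ofReal_radius_rpow {Z : Type u} [MetricSpace Z]
    (F : HyperbolicFilling Z s) (hs : 1 < s) (hQ : 0 < Q) (k : ℕ) :
    (ENNReal.ofReal (F.radius k) ^ Q)⁻¹ =
      (ENNReal.ofReal F.scale ^ Q)⁻¹ * ENNReal.ofReal (s ^ Q) ^ k := by
  have hs0 : 0 < s := by linarith
  rw [F.radius_eq, ENNReal.ofReal_div_of_pos (by positivity), ENNReal.div_rpow_of_nonneg _ _ hQ.le,
    ENNReal.inv_div (Or.inl ?_) (Or.inl ?_), ENNReal.div_eq_inv_mul]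
  · rw [ENNReal.ofReal_pow hs0.le, ← ENNReal.ofReal_rpow_of_pos hs0, ← ENNReal.rpow_natCast,
      ← ENNReal.rpow_natCast, ← ENNReal.rpow_mul, ← ENNReal.rpow_mul,
      mul_comm (k : ℝ), mul_comm]
  · exact ENNReal.rpow_ne_top_of_nonneg hQ.le ENNReal.ofReal_ne_top
  · have := F.scale_pos
    have h2 : 0 < ENNReal.ofReal (s ^ k) := ENNReal.ofReal_pos.2 (by positivity)
    exact (ENNReal.rpow_pos h2 ENNReal.ofReal_ne_top).ne'

/-- The weak-type estimate for the weights `v ↦ 4 r_v inf_{B_v} g ^ (1 / Q)`. -/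
lemma IsAhlforsRegular.encard_lt_le (h : IsAhlforsRegular μ Q a b) (hQ : 0 < Q) (hs : 1 < s)
    (F : HyperbolicFilling Z s) {k₀ : ℕ}
    (hk₀ : 3 * F.radius k₀ ≤ Metric.diam (univ : Set Z)) {g : Z → ℝ≥0∞} (hg : Measurable g)
    {G : ℝ≥0∞} (hG1 : 1 ≤ G)
    (hG : G + ENNReal.ofReal (s ^ Q) ≤ G * ENNReal.ofReal (s ^ Q)) {l : ℝ≥0∞} (hl : l ≠ 0)
    (hl' : l ≠ ∞) :
    ({v : F.Vertex | k₀ ≤ F.level v ∧ l < ENNReal.ofReal (4 * F.radius (F.level v)) *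
        ⨅ x ∈ F.ball v, g x ^ Q⁻¹}.encard : ℝ≥0∞) ≤
      ENNReal.ofReal (b / a * 6 ^ Q) * (ENNReal.ofReal a)⁻¹ * G * 4 ^ Q * (∫⁻ z, g z ∂μ) / l ^ Q := by
  set E := {v : F.Vertex | k₀ ≤ F.level v ∧ l < ENNReal.ofReal (4 * F.radius (F.level v)) *
        ⨅ x ∈ F.ball v, g x ^ Q⁻¹} with hE
  have := F.countable_vertex hs
  have ha := h.1
  have hα : ENNReal.ofReal a ≠ 0 := (ENNReal.ofReal_pos.2 ha).ne'
  let α := (ENNReal.ofReal a)⁻¹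
  let w : ℕ → ℝ≥0∞ := fun k => (ENNReal.ofReal (F.radius k) ^ Q)⁻¹
  have hR0 : ∀ k, ENNReal.ofReal (F.radius k) ^ Q ≠ 0 := fun k =>
    (ENNReal.rpow_pos (ENNReal.ofReal_pos.2 (F.radius_pos hs k)) ENNReal.ofReal_ne_top).ne'
  have hRt : ∀ k, ENNReal.ofReal (F.radius k) ^ Q ≠ ∞ := fun k =>
    ENNReal.rpow_ne_top_of_nonneg hQ.le ENNReal.ofReal_ne_top
  have hlQ0 : l ^ Q ≠ 0 := (ENNReal.rpow_pos (pos_iff_ne_zero.2 hl) hl').ne'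
  have hlQt : l ^ Q ≠ ∞ := ENNReal.rpow_ne_top_of_nonneg hQ.le hl'
  let X : Z → ℝ≥0∞ := fun x => 4 ^ Q * g x / l ^ Q
  have hX : Measurable X := (hg.const_mul _).div_const _
  -- Each counted vertex spreads mass at least one over its ball. The cutoff by X, automatic on the
  -- balls of counted vertices, is what makes the sum over all levels converge.
  let H : F.Vertex → Z → ℝ≥0∞ := fun v =>
    (F.ball v ∩ {x | k₀ ≤ F.level v ∧ w (F.level v) < X x}).indicator
      fun _ => α * w (F.level v)
  have hHm : ∀ v, MeasurableSet (F.ball v ∩ {x | k₀ ≤ F.level v ∧ w (F.level v) < X x}) :=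
    fun v => Metric.isOpen_ball.measurableSet.inter
      ((MeasurableSet.const _).inter (measurableSet_lt measurable_const hX))
  have h1 : ∀ v ∈ E, 1 ≤ ∫⁻ x, H v x ∂μ := by
    rintro v ⟨hv, hlv⟩
    have hsub : F.ball v ⊆ {x | k₀ ≤ F.level v ∧ w (F.level v) < X x} := by
      intro x hx
      refine ⟨hv, ?_⟩
      have hlt : l < ENNReal.ofReal (4 * F.radius (F.level v)) * g x ^ Q⁻¹ :=
        hlv.trans_le (by gcongr; exact iInf₂_le x hx)
      have := ENNReal.rpow_lt_rpow hlt hQ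
      rw [ENNReal.mul_rpow_of_nonneg _ _ hQ.le, ENNReal.rpow_inv_rpow hQ.ne',
        ENNReal.ofReal_mul (by norm_num), ENNReal.mul_rpow_of_nonneg _ _ hQ.le,
        ENNReal.ofReal_ofNat] at this
      simp only [w, X]
      rw [ENNReal.lt_div_iff_mul_lt (Or.inl hlQ0) (Or.inl hlQt), mul_comm, ← div_eq_mul_inv,
        ENNReal.div_lt_iff (Or.inl (hR0 _)) (Or.inl (hRt _))]
      calc _ < _ := this
        _ = _ := by ring
    simp only [H]
    have hbm : MeasurableSet (F.ball v) := Metric.isOpen_ball.measurableSet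
    rw [inter_eq_self_of_subset_left hsub, lintegral_indicator_const hbm]
    have hr := F.radius_pos hs (F.level v)
    have hrd : F.radius (F.level v) ≤ Metric.diam (univ : Set Z) := by
      linarith [F.antitone_radius hs hv]
    have hμ : ENNReal.ofReal a * ENNReal.ofReal (F.radius (F.level v)) ^ Q ≤ μ (F.ball v) := by
      rw [ENNReal.ofReal_rpow_of_pos hr, ← ENNReal.ofReal_mul ha.le]
      refine ((h.2.2 (F.center v) _ hr hrd).1).trans (measure_mono ?_)
      rw [F.ball_eq]
      exact Metric.ball_subset_ball (by linarith)
    calc (1 : ℝ≥0∞) = α * w (F.level v) *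
          (ENNReal.ofReal a * ENNReal.ofReal (F.radius (F.level v)) ^ Q) := by
          simp only [α, w]
          rw [mul_mul_mul_comm, ENNReal.inv_mul_cancel hα ENNReal.ofReal_ne_top,
            ENNReal.inv_mul_cancel (hR0 _) (hRt _), one_mul]
      _ ≤ _ := by gcongr
  have h2 : ∀ x, ∑' v, H v x ≤ ENNReal.ofReal (b / a * 6 ^ Q) * α * (G * X x) := by
    intro x
    calc ∑' v, H v x = ∑' k, ∑' y : F.P k, H (⟨k, y⟩ : Σ k, F.P k) x :=
          ENNReal.tsum_sigma fun k (y : F.P k) => H (⟨k, y⟩ : Σ k, F.P k) x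
      _ ≤ ∑' k, ENNReal.ofReal (b / a * 6 ^ Q) * α * (if w k < X x then w k else 0) := by
          refine ENNReal.tsum_le_tsum fun k => ?_
          by_cases hk : k₀ ≤ k ∧ w k < X x
          · rw [if_pos hk.2, mul_assoc]
            have : ∀ y : F.P k, H (⟨k, y⟩ : Σ k, F.P k) x =
                {y : F.P k | x ∈ Metric.ball (y : Z) (2 * F.radius k)}.indicator
                  (fun _ => α * w k) y := by
              intro y
              by_cases hy : x ∈ Metric.ball (y : Z) (2 * F.radius k)
              · rw [indicator_of_mem (by exact hy)]
                have hm : x ∈ F.ball (⟨k, y⟩ : Σ k, F.P k) ∩ {x | k₀ ≤ k ∧ w k < X x} := ⟨hy, hk⟩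
                exact indicator_of_mem hm _
              · rw [indicator_of_notMem (by exact hy)]
                exact indicator_of_notMem (fun hx => hy hx.1) _
            simp only [this]
            rw [← tsum_subtype, ENNReal.tsum_set_const]
            gcongr
            exact h.encard_mem_ball_le hs F (by linarith [F.antitone_radius hs hk.1]) x
          · have : ∀ y : F.P k, H (⟨k, y⟩ : Σ k, F.P k) x = 0 := fun y =>
              indicator_of_notMem (fun hx => hk hx.2) _
            simp [this]
      _ ≤ _ := by
          rw [ENNReal.tsum_mul_left]
          gcongr
          simp only [w, F.inv_ofReal_radius_rpow hs hQ]
          exact tsum_geometric_lt_le hG1 hG _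
  calc (E.encard : ℝ≥0∞) = ∑' _ : E, 1 := (ENNReal.tsum_set_one E).symm
    _ ≤ ∑' v : E, ∫⁻ x, H v x ∂μ := ENNReal.tsum_le_tsum fun v => h1 v v.2
    _ ≤ ∑' v, ∫⁻ x, H v x ∂μ :=
        ENNReal.tsum_comp_le_tsum_of_injective Subtype.val_injective _
    _ = ∫⁻ x, ∑' v, H v x ∂μ :=
        (lintegral_tsum fun v => (measurable_const.indicator (hHm v)).aemeasurable).symm
    _ ≤ ∫⁻ x, ENNReal.ofReal (b / a * 6 ^ Q) * α * (G * X x) ∂μ := lintegral_mono h2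
    _ = ∫⁻ x, (ENNReal.ofReal (b / a * 6 ^ Q) * α * G * 4 ^ Q * (l ^ Q)⁻¹) * g x ∂μ := by
        refine lintegral_congr fun x => ?_
        simp only [X, div_eq_mul_inv]
        ring
    _ = _ := by
        rw [lintegral_const_mul _ hg, ENNReal.div_eq_inv_mul (b := l ^ Q)]
        simp only [α]
        ring

lemma weakNorm_rpow_le {X : Type u} {p : ℝ} (hp : 0 < p) {f : X → ℝ≥0∞} {A : ℝ≥0∞} (hA : A ≠ 0)
    (hA' : A ≠ ∞) (h : ∀ l : ℝ≥0, 0 < l →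
      (({x : X | (l : ℝ≥0∞) < f x}.encard : ℕ∞) : ℝ≥0∞) ≤ A / (l : ℝ≥0∞) ^ p) :
    weakNorm p f ^ p ≤ A := by
  lift A to ℝ≥0 using hA'
  have hA0 : A ≠ 0 := by simpa using hA
  have hK : ((A ^ p⁻¹ : ℝ≥0) : ℝ≥0∞) ^ p = A := by
    rw [ENNReal.coe_rpow_of_nonneg _ (inv_nonneg.2 hp.le), ENNReal.rpow_inv_rpow hp.ne']
  rw [← hK]
  refine ENNReal.rpow_le_rpow (iInf₂_le _ ⟨NNReal.rpow_pos (pos_iff_ne_zero.2 hA0), ?_⟩) hp.le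
  intro l hl
  rw [hK]
  exact h l hl

/-- There is an upper bound for the capacity by the energy of any admissible function. -/
lemma IsAhlforsRegular.weakCoveringCapacity_le_lintegral (h : IsAhlforsRegular μ Q a b)
    (hQ : 0 < Q) (hs : 1 < s) (F : HyperbolicFilling Z s) {Γ : Set C(I, Z)} {G : ℝ≥0∞}
    (hG1 : 1 ≤ G) (hGt : G ≠ ∞)
    (hG : G + ENNReal.ofReal (s ^ Q) ≤ G * ENNReal.ofReal (s ^ Q)) {ρ : Z → ℝ≥0∞}
    (hρ : ModAdmissible Γ ρ) :
    F.weakCoveringCapacity Q Γ ≤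
      ENNReal.ofReal (b / a * 6 ^ Q) * (ENNReal.ofReal a)⁻¹ * G * 4 ^ Q * ∫⁻ z, ρ z ^ Q ∂μ := by
  have ha := h.1
  have hb := h.2.1
  have hα : ENNReal.ofReal a ≠ 0 := (ENNReal.ofReal_pos.2 ha).ne'
  -- In diameter zero all paths are constant, so an admissible ρ exists only for the empty family.
  rcases (Metric.diam_nonneg (s := (univ : Set Z))).eq_or_lt with hd | hd
  · have hsub : Subsingleton Z := by
      refine ⟨fun x y => dist_le_zero.1 ?_⟩
      rw [hd]
      exact Metric.dist_le_diam_of_mem isCompact_univ.isBounded (mem_univ x) (mem_univ y)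
    have hΓ : Γ = ∅ := by
      refine eq_empty_of_forall_notMem fun γ hγ => ?_
      have h0 : pathLength γ = 0 := eVariationOn.constant_on subsingleton_of_subsingleton
      have := hρ.2 γ hγ (by simp [IsRectifiable, h0])
      simp [pathIntegral_eq_zero_of_pathLength h0] at this
    refine (iInf₂_le (fun _ => 0) (by simp [hΓ])).trans ?_
    have : weakNorm Q (fun _ : F.Vertex => (0 : ℝ≥0∞)) = 0 := by
      refine le_antisymm (ENNReal.le_of_forall_pos_le_add fun ε hε _ => ?_) zero_le
      rw [zero_add]
      exact iInf₂_le ε ⟨hε, by simp⟩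
    simp [this, ENNReal.zero_rpow_of_pos hQ]
  set C := ENNReal.ofReal (b / a * 6 ^ Q) * (ENNReal.ofReal a)⁻¹ * G * 4 ^ Q with hC
  have hC0 : C ≠ 0 := by
    have h1 : ENNReal.ofReal (b / a * 6 ^ Q) ≠ 0 := (ENNReal.ofReal_pos.2 (by positivity)).ne'
    have h2 : G ≠ 0 := (zero_lt_one.trans_le hG1).ne'
    have h3 : (4 : ℝ≥0∞) ^ Q ≠ 0 := (ENNReal.rpow_pos (by norm_num) (by norm_num)).ne'
    simp only [hC, mul_ne_zero_iff, ne_eq, ENNReal.inv_eq_zero]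
    exact ⟨⟨⟨h1, ENNReal.ofReal_ne_top⟩, h2⟩, h3⟩
  have hCt : C ≠ ∞ := by
    refine ENNReal.mul_ne_top (ENNReal.mul_ne_top (ENNReal.mul_ne_top ENNReal.ofReal_ne_top
      (ENNReal.inv_ne_top.2 hα)) hGt) (ENNReal.rpow_ne_top_of_nonneg hQ.le (by norm_num))
  have := h.isFiniteMeasure hd
  have hμ : 0 < μ univ := by
    obtain ⟨z, -⟩ : (univ : Set Z).Nonempty := by
      by_contra! hemp
      simp [hemp] at hd
    exact (ENNReal.ofReal_pos.2 (mul_pos ha (Real.rpow_pos_of_pos hd Q))).trans_le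
      ((h.2.2 z _ hd le_rfl).1.trans (measure_mono (subset_univ _)))
  obtain ⟨k₀, hk₀⟩ := ((F.tendsto_radius hs).eventually_le_const
    (show (0 : ℝ) < Metric.diam (univ : Set Z) / 3 by positivity)).exists
  refine ENNReal.le_of_forall_pos_le_add fun ε hε hfin => ?_
  obtain ⟨κ, hκ, hκε⟩ := ENNReal.exists_nnreal_pos_mul_lt
    (ENNReal.mul_ne_top hCt (ENNReal.add_ne_top.2 ⟨measure_ne_top μ univ, ENNReal.one_ne_top⟩))
    (ENNReal.coe_ne_zero.2 hε.ne')
  have hκ0 : (κ : ℝ≥0∞) ≠ 0 := ENNReal.coe_ne_zero.2 hκ.ne'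
  -- Vitali–Carathéodory. The added κ gives the positive lower bound needed on nonrectifiable paths
  -- and a nonzero energy.
  obtain ⟨g, hgρ, hglsc, hgint⟩ := exists_le_lowerSemicontinuous_lintegral_ge μ
    (fun z => ρ z ^ Q + κ) ((hρ.1.pow_const Q).add_const _) hκ0
  have hgκ : ∀ z, (κ : ℝ≥0∞) ≤ g z := fun z => le_add_self.trans (hgρ z)
  have hCg : C * ∫⁻ z, g z ∂μ ≤ C * ∫⁻ z, ρ z ^ Q ∂μ + ε := by
    calc C * ∫⁻ z, g z ∂μ ≤ C * (∫⁻ z, ρ z ^ Q ∂μ + κ * μ univ + κ) := by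
          gcongr
          refine hgint.trans_eq ?_
          rw [lintegral_add_right _ measurable_const, lintegral_const]
      _ = C * ∫⁻ z, ρ z ^ Q ∂μ + κ * (C * (μ univ + 1)) := by ring
      _ ≤ _ := by gcongr
  refine le_trans ?_ hCg
  -- Coarse levels, where the regularity bounds may not apply, get weight zero; expanding covers
  -- eventually avoid them.
  let τ : F.Vertex → ℝ≥0∞ := fun v => if k₀ ≤ F.level v then
    ENNReal.ofReal (4 * F.radius (F.level v)) * ⨅ x ∈ F.ball v, g x ^ Q⁻¹ else 0
  refine (iInf₂_le τ fun γ hγ => ?_).trans (weakNorm_rpow_le hQ ?_ ?_ fun l hl => ?_)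
  · refine HyperbolicFilling.admissible_of_lowerSemicontinuous hs (ρ := fun z => g z ^ Q⁻¹)
      (δ := (κ : ℝ≥0∞) ^ Q⁻¹) (k₀ := k₀) ?_ ?_ ?_ (fun z => ?_) (fun hr => ?_)
      fun v hv => if_pos hv
    · exact (ENNReal.continuous_rpow_const (y := Q⁻¹)).comp_lowerSemicontinuous hglsc
        (ENNReal.monotone_rpow_of_nonneg (inv_nonneg.2 hQ.le))
    · exact (ENNReal.rpow_pos (pos_iff_ne_zero.2 hκ0) ENNReal.coe_ne_top).ne'
    · exact ENNReal.rpow_ne_top_of_nonneg (inv_nonneg.2 hQ.le) ENNReal.coe_ne_top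
    · exact ENNReal.rpow_le_rpow (hgκ z) (inv_nonneg.2 hQ.le)
    · refine (hρ.2 γ hγ hr).trans (pathIntegral_mono fun z => ?_)
      rw [ENNReal.le_rpow_inv_iff hQ]
      exact le_self_add.trans (hgρ z)
  · refine mul_ne_zero hC0 (ne_of_gt ?_)
    calc 0 < ∫⁻ _, (κ : ℝ≥0∞) ∂μ := by
          rw [lintegral_const]
          exact ENNReal.mul_pos hκ0 hμ.ne'
      _ ≤ _ := lintegral_mono hgκ
  · exact (hCg.trans_lt (ENNReal.add_lt_top.2 ⟨hfin, ENNReal.coe_lt_top⟩)).ne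
  · refine le_trans ?_ (h.encard_lt_le hQ hs F (by linarith) hglsc.measurable hG1 hG
      (ENNReal.coe_ne_zero.2 hl.ne') ENNReal.coe_ne_top)
    refine ENat.toENNReal_mono (Set.encard_le_encard fun v hv => ?_)
    simp only [mem_ofPred_eq, τ] at hv ⊢
    split_ifs at hv with hk
    · exact ⟨hk, hv⟩
    · simp at hv

end Counting

/-! ### The modulus is bounded by the capacity -/

section WeakType

variable {X : Type u} {Q s : ℝ} {f : X → ℝ≥0∞} {K : ℝ≥0}

/-- For l > K the bound on the number of points is below one, so no value exceeds K. -/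
lemma le_of_weakType (hQ : 0 < Q)
    (hK : ∀ l : ℝ≥0, 0 < l →
      (({x : X | (l : ℝ≥0∞) < f x}.encard : ℕ∞) : ℝ≥0∞) ≤ (K : ℝ≥0∞) ^ Q / (l : ℝ≥0∞) ^ Q)
    (x : X) : f x ≤ K := by
  by_contra! hx
  obtain ⟨l, hKl, hlx⟩ := ENNReal.lt_iff_exists_nnreal_btwn.1 hx
  have hl0 : 0 < l := (zero_le (a := K)).trans_lt (ENNReal.coe_lt_coe.1 hKl)
  have h1 : (1 : ℝ≥0∞) ≤ (({x : X | (l : ℝ≥0∞) < f x}.encard : ℕ∞) : ℝ≥0∞) := by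
    have : (1 : ℕ∞) ≤ {x : X | (l : ℝ≥0∞) < f x}.encard := Set.one_le_encard_iff_nonempty.2 ⟨x, hlx⟩
    exact_mod_cast ENat.toENNReal_mono this
  have h2 : (K : ℝ≥0∞) ^ Q / (l : ℝ≥0∞) ^ Q < 1 := by
    refine ENNReal.div_lt_of_lt_mul' ?_
    rw [mul_one]
    exact ENNReal.rpow_lt_rpow hKl hQ
  exact absurd (h1.trans (hK l hl0)) (not_le.2 h2)

/-- The `ℓ^Q`-sum of a weak `ℓ^Q` function over a finite set grows at most logarithmically with
the number of elements. -/
lemma sum_rpow_le_of_weakType (hQ : 0 < Q) (hs : 1 < s) (hK0 : 0 < K)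
    (hK : ∀ l : ℝ≥0, 0 < l →
      (({x : X | (l : ℝ≥0∞) < f x}.encard : ℕ∞) : ℝ≥0∞) ≤ (K : ℝ≥0∞) ^ Q / (l : ℝ≥0∞) ^ Q)
    (T : Finset X) (J : ℕ) :
    ∑ x ∈ T, f x ^ Q ≤ J * (ENNReal.ofReal (s ^ Q) * (K : ℝ≥0∞) ^ Q) +
      T.card * ((K : ℝ≥0∞) ^ Q * (ENNReal.ofReal (s ^ Q))⁻¹ ^ J) := by
  classical
  have hs0 : 0 < s := by linarith
  set q := ENNReal.ofReal (s ^ Q) with hq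
  set κ := (K : ℝ≥0∞) ^ Q with hκ
  have hq0 : q ≠ 0 := (ENNReal.ofReal_pos.2 (by positivity)).ne'
  have hqt : q ≠ ∞ := ENNReal.ofReal_ne_top
  have hκ0 : κ ≠ 0 := (ENNReal.rpow_pos (ENNReal.coe_pos.2 hK0) ENNReal.coe_ne_top).ne'
  have hκt : κ ≠ ∞ := ENNReal.rpow_ne_top_of_nonneg hQ.le ENNReal.coe_ne_top
  -- Layers with ratio q = s^Q: stop at the first j with κ q^{-(j+1)} < f(x)^Q, or after J layers.
  -- Layer j has at most q^{j+1} points, so each layer contributes at most q κ.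
  have hpt : ∀ x, ∀ J : ℕ, f x ^ Q ≤
      ∑ j ∈ Finset.range J, (if κ * q⁻¹ ^ (j + 1) < f x ^ Q then κ * q⁻¹ ^ j else 0) +
        κ * q⁻¹ ^ J := by
    intro x J
    induction J with
    | zero =>
      simpa using ENNReal.rpow_le_rpow (le_of_weakType hQ hK x) hQ.le
    | succ J ih =>
      rw [Finset.sum_range_succ]
      split_ifs with h
      · exact ih.trans le_self_add
      · exact (not_lt.1 h).trans le_add_self
  have hcount : ∀ j : ℕ, ((T.filter fun x => κ * q⁻¹ ^ (j + 1) < f x ^ Q).card : ℝ≥0∞) ≤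
      q ^ (j + 1) := by
    intro j
    let l : ℝ≥0 := K * (s.toNNReal⁻¹) ^ (j + 1)
    have hsn : 0 < s.toNNReal := Real.toNNReal_pos.2 hs0
    have hl : 0 < l := by positivity
    have hlQ : (l : ℝ≥0∞) ^ Q = κ * q⁻¹ ^ (j + 1) := by
      simp only [l, hκ, hq]
      rw [ENNReal.coe_mul, ENNReal.mul_rpow_of_nonneg _ _ hQ.le, ENNReal.coe_pow,
        ENNReal.coe_inv hsn.ne', ← ENNReal.ofReal_rpow_of_pos hs0, ← ENNReal.inv_rpow,
        ← ENNReal.rpow_natCast, ← ENNReal.rpow_natCast, ← ENNReal.rpow_mul, ← ENNReal.rpow_mul,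
        mul_comm Q]
      rfl
    calc ((T.filter fun x => κ * q⁻¹ ^ (j + 1) < f x ^ Q).card : ℝ≥0∞)
        = (((T.filter fun x => κ * q⁻¹ ^ (j + 1) < f x ^ Q : Finset X) : Set X).encard : ℝ≥0∞) := by
          rw [Set.encard_coe_eq_coe_finsetCard]
          simp
      _ ≤ (({x : X | (l : ℝ≥0∞) < f x}.encard : ℕ∞) : ℝ≥0∞) := by
          refine ENat.toENNReal_mono (Set.encard_le_encard fun x hx => ?_)
          have := (Finset.mem_filter.1 (Finset.mem_coe.1 hx)).2
          rw [← hlQ] at this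
          exact (ENNReal.rpow_lt_rpow_iff hQ).1 this
      _ ≤ κ / (l : ℝ≥0∞) ^ Q := hK l hl
      _ = q ^ (j + 1) := by
          rw [hlQ, eq_comm, ENNReal.eq_div_iff
            (mul_ne_zero hκ0 (pow_ne_zero _ (ENNReal.inv_ne_zero.2 hqt)))
            (ENNReal.mul_ne_top hκt (ENNReal.pow_ne_top (ENNReal.inv_ne_top.2 hq0))), mul_assoc,
            ← mul_pow, ENNReal.inv_mul_cancel hq0 hqt, one_pow, mul_one]
  calc ∑ x ∈ T, f x ^ Q
      ≤ ∑ x ∈ T, (∑ j ∈ Finset.range J,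
          (if κ * q⁻¹ ^ (j + 1) < f x ^ Q then κ * q⁻¹ ^ j else 0) + κ * q⁻¹ ^ J) :=
        Finset.sum_le_sum fun x _ => hpt x J
    _ = ∑ j ∈ Finset.range J, (T.filter fun x => κ * q⁻¹ ^ (j + 1) < f x ^ Q).card *
          (κ * q⁻¹ ^ j) + T.card * (κ * q⁻¹ ^ J) := by
        rw [Finset.sum_add_distrib, Finset.sum_comm, Finset.sum_const, nsmul_eq_mul]
        congr 1
        refine Finset.sum_congr rfl fun j _ => ?_
        rw [← Finset.sum_filter, Finset.sum_const, nsmul_eq_mul]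
    _ ≤ ∑ j ∈ Finset.range J, q * κ + T.card * (κ * q⁻¹ ^ J) := by
        refine add_le_add (Finset.sum_le_sum fun j _ => ?_) le_rfl
        calc _ ≤ q ^ (j + 1) * (κ * q⁻¹ ^ j) := by gcongr; exact hcount j
          _ = (q * q⁻¹) ^ j * (q * κ) := by rw [mul_pow]; ring
          _ = q * κ := by rw [ENNReal.mul_inv_cancel hq0 hqt, one_pow, one_mul]
    _ = _ := by rw [Finset.sum_const, nsmul_eq_mul, Finset.card_range]

end WeakType

/-! ### Level functions and equal-length subdivisions -/

namespace HyperbolicFilling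

variable {Z : Type u} [MetricSpace Z] {s : ℝ}

lemma exists_projection {F : HyperbolicFilling Z s} {γ : C(I, Z)} {S : Set F.Vertex} {t : ℕ → I}
    {m : ℕ} {v : ℕ → F.Vertex} (ht : ∀ k < m, t k < t (k + 1)) (h0 : t 0 = 0) (h1 : t m = 1)
    (hv : ∀ k < m, v k ∈ S) (hb : ∀ k < m, ∀ x ∈ Icc (t k) (t (k + 1)), γ x ∈ F.ball (v k)) :
    ∃ P : F.Projection γ S, ∀ τ : F.Vertex → ℝ≥0∞,
      P.tauLength τ = ∑ k ∈ Finset.range m, τ (v k) := by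
  refine ⟨⟨m, fun k => t k, Fin.strictMono_iff_lt_succ.2 fun k => ?_, ?_, ?_, fun k => v k,
    fun k => hv k k.2, fun k => ?_⟩, fun τ => ?_⟩
  · simpa using ht k k.2
  · simpa using h0
  · simpa using h1
  · rintro - ⟨x, hx, rfl⟩
    exact hb k k.2 x (by simpa using hx)
  · exact Fin.sum_univ_eq_sum_range (fun k => τ (v k)) m

/-- The function on `Z` induced by the weights of the vertices of a given level. -/
def levelFunction (F : HyperbolicFilling Z s) (τ : F.Vertex → ℝ≥0∞) (k : ℕ) (z : Z) : ℝ≥0∞ :=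
  ⨆ v ∈ F.vertices k, (F.ball v).indicator (fun _ => τ v / ENNReal.ofReal (F.radius k)) z

lemma le_levelFunction (F : HyperbolicFilling Z s) (τ : F.Vertex → ℝ≥0∞) {k : ℕ} {v : F.Vertex}
    (hv : v ∈ F.vertices k) {z : Z} (hz : z ∈ F.ball v) :
    τ v / ENNReal.ofReal (F.radius k) ≤ F.levelFunction τ k z := by
  refine le_trans ?_ (le_iSup₂ v hv)
  rw [indicator_of_mem hz]

lemma measurable_levelFunction [CompactSpace Z] [MeasurableSpace Z] [BorelSpace Z]
    (F : HyperbolicFilling Z s) (hs : 1 < s) (τ : F.Vertex → ℝ≥0∞) (k : ℕ) :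
    Measurable (F.levelFunction τ k) :=
  .biSup _ (F.finite_vertices hs k).countable fun _ _ =>
    measurable_const.indicator Metric.isOpen_ball.measurableSet

/-- Subdividing a path into pieces of equal length yields a projection whose length is controlled
by a path integral. -/
lemma exists_projection_tauLength_le (F : HyperbolicFilling Z s) (hs : 1 < s) {γ : C(I, Z)}
    (hγ : IsRectifiable γ) {k : ℕ} (hk : F.radius k ≤ (pathLength γ).toReal)
    (τ : F.Vertex → ℝ≥0∞) :
    ∃ P : F.Projection γ (F.vertices k),
      P.tauLength τ ≤ 2 * pathIntegral (F.levelFunction τ k) γ := by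
  set ℓ := (pathLength γ).toReal with hℓ
  set r := F.radius k with hr
  have hr0 : 0 < r := F.radius_pos hs k
  -- Rounding up yields r/2 ≤ h ≤ r: the upper bound keeps each piece in a ball of radius 2r, the
  -- lower bound costs the factor 2.
  set N := ⌈ℓ / r⌉₊ with hN
  have hN1 : ℓ / r ≤ N := Nat.le_ceil _
  have hN2 : (N : ℝ) < ℓ / r + 1 := Nat.ceil_lt_add_one (by positivity)
  have h1 : 1 ≤ ℓ / r := (one_le_div hr0).2 hk
  have hN0 : (0 : ℝ) < N := by linarith
  set h := ℓ / N with hh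
  have hhr : h ≤ r := by rw [hh, div_le_iff₀ hN0]; rwa [div_le_iff₀ hr0, mul_comm] at hN1
  have hrh : r ≤ 2 * h := by
    have : (N : ℝ) ≤ 2 * (ℓ / r) := by linarith
    rw [hh, ← mul_div_assoc, le_div_iff₀ hN0]
    rw [← mul_div_assoc, le_div_iff₀ hr0] at this
    linarith
  have hh0 : 0 < h := by linarith
  have hNh : N * h = ℓ := by rw [hh]; field_simp
  -- Arclength can be constant on intervals, so the parameters 0 and 1 are imposed at the ends
  -- rather than recovered from the lengths.
  have hex : ∀ i : ℕ, ∃ x : I, arclength γ x = min (i : ℝ) (N : ℝ) * h ∧ (i = 0 → x = 0) ∧ (N ≤ i → x = 1) := by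
    intro i
    rcases Nat.eq_zero_or_pos i with rfl | hi
    · refine ⟨0, by simp [arclength_zero], fun _ => rfl, fun hN' => ?_⟩
      have : (N : ℝ) ≤ 0 := by exact_mod_cast hN'
      linarith
    by_cases hiN : N ≤ i
    · refine ⟨1, ?_, fun h => by omega, fun _ => rfl⟩
      rw [arclength_one, min_eq_right (by exact_mod_cast hiN), hNh]
    · have hiN' : (i : ℝ) ≤ N := by exact_mod_cast (not_le.1 hiN).le
      obtain ⟨x, -, hx⟩ := hγ.exists_arclength_eq (zero_le_one : (0 : I) ≤ 1) (l := min (i : ℝ) (N : ℝ) * h) (by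
        rw [arclength_zero, arclength_one, ← hℓ, min_eq_left hiN', ← hNh]
        exact ⟨by positivity, by gcongr⟩)
      exact ⟨x, hx, fun h => by omega, fun h => absurd h hiN⟩
  choose t ht ht0 ht1 using hex
  have hdiff : ∀ i < N, arclength γ (t (i + 1)) - arclength γ (t i) = h := by
    intro i hi
    have hi1 : (i : ℝ) ≤ N := by exact_mod_cast hi.le
    have hi2 : ((i + 1 : ℕ) : ℝ) ≤ N := by exact_mod_cast hi
    rw [ht, ht, min_eq_left hi1, min_eq_left hi2]
    push_cast
    ring
  have hlt : ∀ i < N, t i < t (i + 1) := by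
    intro i hi
    by_contra! hle
    linarith [hγ.monotone_arclength hle, hdiff i hi]
  have hmono : Monotone t := monotone_nat_of_le_succ fun i => by
    by_cases hi : i < N
    · exact (hlt i hi).le
    · rw [ht1 i (by omega), ht1 (i + 1) (by omega)]
  have hvar : ∀ i < N, eVariationOn γ (Icc (t i) (t (i + 1))) = ENNReal.ofReal h := fun i hi => by
    rw [← hγ.arclength_sub (hlt i hi).le, hdiff i hi]
  choose v hv hvdist using fun i => F.exists_vertex_dist_lt hs k (γ (t i))
  have hball : ∀ i < N, ∀ x ∈ Icc (t i) (t (i + 1)), γ x ∈ F.ball (v i) := by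
    intro i hi x hx
    have h2 : edist (γ x) (γ (t i)) ≤ ENNReal.ofReal h := by
      rw [← hvar i hi]
      exact eVariationOn.edist_le _ hx ⟨le_rfl, (hlt i hi).le⟩
    rw [edist_le_ofReal hh0.le] at h2
    rw [F.ball_eq, Metric.mem_ball, show F.level (v i) = k from hv i]
    have := hvdist i
    linarith [dist_triangle (γ x) (γ (t i)) (F.center (v i))]
  obtain ⟨P, hP⟩ := exists_projection hlt (ht0 0 rfl) (ht1 N le_rfl) (fun i _ => hv i) hball
  refine ⟨P, ?_⟩
  rw [hP]
  have key := hγ.sum_le_pathIntegral (ρ := F.levelFunction τ k) hmono (ht0 0 rfl) (ht1 N le_rfl)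
    (w := fun i => τ (v i) / ENNReal.ofReal r)
    fun i hi x hx => F.le_levelFunction τ (hv i) (hball i hi x hx)
  refine le_trans ?_ (mul_le_mul_right key 2)
  rw [Finset.mul_sum]
  refine Finset.sum_le_sum fun i hi => ?_
  rw [hvar i (Finset.mem_range.1 hi)]
  calc τ (v i) = τ (v i) / ENNReal.ofReal r * ENNReal.ofReal r :=
        (ENNReal.div_mul_cancel (ENNReal.ofReal_pos.2 hr0).ne' ENNReal.ofReal_ne_top).symm
    _ ≤ τ (v i) / ENNReal.ofReal r * ENNReal.ofReal (2 * h) := by gcongr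
    _ = 2 * (τ (v i) / ENNReal.ofReal r * ENNReal.ofReal h) := by
        rw [ENNReal.ofReal_mul (by norm_num), ENNReal.ofReal_ofNat]
        ring

/-- No weight of finite weak norm is admissible for a constant path. -/
lemma Admissible.pathLength_ne_zero [CompactSpace Z] {F : HyperbolicFilling Z s} (hs : 1 < s)
    {τ : F.Vertex → ℝ≥0∞} {γ : C(I, Z)} (h : F.Admissible τ γ)
    (hfin : {v | ((1 / 2 : ℝ≥0) : ℝ≥0∞) < τ v}.Finite) : pathLength γ ≠ 0 := by
  intro h0
  have hS := F.isExpandingCovers_vertices hs tendsto_id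
  have hlt : ((1 / 2 : ℝ≥0) : ℝ≥0∞) < 1 := by
    rw [← ENNReal.coe_one, ENNReal.coe_lt_coe]
    exact NNReal.half_lt_self one_ne_zero
  -- A constant path projects onto a single vertex of level n. Far out that vertex has weight at
  -- most 1/2, while admissibility demands more.
  obtain ⟨n, hn, hn'⟩ := ((eventually_lt_of_lt_liminf (hlt.trans_le (h _ hS))
    (by isBoundedDefault)).and (hS.expanding _ hfin)).exists
  obtain ⟨v, hv, hvd⟩ := F.exists_vertex_dist_lt hs n (γ 0)
  obtain ⟨P, hP⟩ := exists_projection (F := F) (γ := γ) (S := F.vertices n)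
    (t := fun i => if i = 0 then 0 else 1) (m := 1) (v := fun _ => v) (by simp) (by simp) (by simp)
    (fun _ _ => hv) (fun k _ x _ => by
      have : γ x = γ 0 := edist_eq_zero.1 (nonpos_iff_eq_zero.1
        (h0 ▸ eVariationOn.edist_le γ (mem_univ x) (mem_univ 0)))
      rw [this, F.ball_eq, Metric.mem_ball, show F.level v = n from hv]
      linarith [F.radius_pos hs n])
  have h2 := hn.trans_le (iInf_le _ P)
  rw [hP, Finset.sum_range_one] at h2
  exact (Set.ext_iff.1 hn' v).1 ⟨hv, h2⟩

end HyperbolicFilling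

/-! ### Levels of small energy and the bound for the modulus -/

section LowerBound

variable {Z : Type u} [MetricSpace Z] [CompactSpace Z] [MeasurableSpace Z] [BorelSpace Z]
  {μ : Measure Z} {Q a b s : ℝ}

/-- The power of a supremum is at most the sum of the powers, and μ(B_v) ≤ b (2r)^Q cancels the
normalization by r^Q. -/
lemma IsAhlforsRegular.lintegral_levelFunction_le (h : IsAhlforsRegular μ Q a b) (hQ : 0 < Q)
    (hs : 1 < s) (F : HyperbolicFilling Z s) {k : ℕ}
    (hk : 2 * F.radius k ≤ Metric.diam (univ : Set Z)) (τ : F.Vertex → ℝ≥0∞) :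
    ∫⁻ z, F.levelFunction τ k z ^ Q ∂μ ≤
      ENNReal.ofReal (b * 2 ^ Q) * ∑ v ∈ (F.finite_vertices hs k).toFinset, τ v ^ Q := by
  set R := ENNReal.ofReal (F.radius k) with hR
  have hr := F.radius_pos hs k
  have hb := h.2.1
  have hR0 : R ^ Q ≠ 0 := (ENNReal.rpow_pos (ENNReal.ofReal_pos.2 hr) ENNReal.ofReal_ne_top).ne'
  have hRt : R ^ Q ≠ ∞ := ENNReal.rpow_ne_top_of_nonneg hQ.le ENNReal.ofReal_ne_top
  have hball : ∀ v, MeasurableSet (F.ball v) := fun v => Metric.isOpen_ball.measurableSet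
  have hpt : ∀ z, F.levelFunction τ k z ^ Q ≤ ∑ v ∈ (F.finite_vertices hs k).toFinset,
      (F.ball v).indicator (fun _ => (τ v / R) ^ Q) z := by
    intro z
    rw [← ENNReal.le_rpow_inv_iff hQ]
    refine iSup₂_le fun v hv => ?_
    rw [ENNReal.le_rpow_inv_iff hQ]
    by_cases hz : z ∈ F.ball v
    · refine le_trans (le_of_eq ?_) (Finset.single_le_sum (f := fun v =>
        (F.ball v).indicator (fun _ => (τ v / R) ^ Q) z) (fun _ _ => zero_le)
        ((Set.Finite.mem_toFinset _).2 hv))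
      simp only [indicator_of_mem hz, hR]
    · rw [indicator_of_notMem hz, ENNReal.zero_rpow_of_pos hQ]
      exact zero_le
  calc ∫⁻ z, F.levelFunction τ k z ^ Q ∂μ
      ≤ ∫⁻ z, ∑ v ∈ (F.finite_vertices hs k).toFinset,
          (F.ball v).indicator (fun _ => (τ v / R) ^ Q) z ∂μ := lintegral_mono hpt
    _ = ∑ v ∈ (F.finite_vertices hs k).toFinset, (τ v / R) ^ Q * μ (F.ball v) := by
        rw [lintegral_finsetSum _ fun v _ => measurable_const.indicator (hball v)]
        exact Finset.sum_congr rfl fun v _ => lintegral_indicator_const (hball v) _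
    _ ≤ ∑ v ∈ (F.finite_vertices hs k).toFinset, ENNReal.ofReal (b * 2 ^ Q) * τ v ^ Q := by
        refine Finset.sum_le_sum fun v hv => ?_
        have hvk : F.level v = k := (F.finite_vertices hs k).mem_toFinset.1 hv
        have hμ : μ (F.ball v) ≤ ENNReal.ofReal (b * 2 ^ Q) * R ^ Q := by
          rw [F.ball_eq, hvk, hR, ENNReal.ofReal_rpow_of_pos hr,
            ← ENNReal.ofReal_mul (by positivity), mul_assoc,
            ← Real.mul_rpow (by norm_num) hr.le]
          exact (h.2.2 _ _ (by linarith) hk).2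
        calc (τ v / R) ^ Q * μ (F.ball v)
            ≤ τ v ^ Q / R ^ Q * (ENNReal.ofReal (b * 2 ^ Q) * R ^ Q) := by
              rw [ENNReal.div_rpow_of_nonneg _ _ hQ.le]
              gcongr
          _ = ENNReal.ofReal (b * 2 ^ Q) * (τ v ^ Q / R ^ Q * R ^ Q) := by ring
          _ = _ := by rw [ENNReal.div_mul_cancel hR0 hRt]
    _ = _ := (Finset.mul_sum ..).symm

/-- For a weak `ℓ^Q` weight, there are arbitrarily large levels on which the `ℓ^Q`-sum is
controlled. -/
lemma IsAhlforsRegular.exists_level_sum_le (h : IsAhlforsRegular μ Q a b) (hQ : 0 < Q)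
    (hs : 1 < s) (hd : 0 < Metric.diam (univ : Set Z)) (F : HyperbolicFilling Z s)
    {τ : F.Vertex → ℝ≥0∞} {K : ℝ≥0} (hK0 : 0 < K)
    (hK : ∀ l : ℝ≥0, 0 < l →
      (({x | (l : ℝ≥0∞) < τ x}.encard : ℕ∞) : ℝ≥0∞) ≤ (K : ℝ≥0∞) ^ Q / (l : ℝ≥0∞) ^ Q)
    (n₀ : ℕ) :
    ∃ n ≥ n₀, ∑ v ∈ (F.finite_vertices hs n).toFinset, τ v ^ Q ≤
      (3 * ENNReal.ofReal (s ^ Q) + 1) * (K : ℝ≥0∞) ^ Q := by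
  classical
  obtain ⟨A, hA⟩ := h.exists_encard_vertices_le hs hd F
  obtain ⟨k₁, hk₁⟩ := ((F.tendsto_radius hs).eventually_le_const hd).exists
  have hsQ : 1 < s ^ Q := Real.one_lt_rpow hs hQ
  obtain ⟨J, hJ⟩ := pow_unbounded_of_one_lt (A : ℝ) hsQ
  set q := ENNReal.ofReal (s ^ Q) with hq
  set κ := (K : ℝ≥0∞) ^ Q with hκ
  have hq1 : 1 ≤ q := by rw [hq, ENNReal.one_le_ofReal]; exact hsQ.le
  have hq0 : q ≠ 0 := (zero_lt_one.trans_le hq1).ne'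
  have hqt : q ≠ ∞ := ENNReal.ofReal_ne_top
  have hAJ : (A : ℝ≥0∞) ≤ q ^ J := by
    rw [hq, ← ENNReal.ofReal_pow (by positivity), ← ENNReal.ofReal_coe_nnreal]
    exact ENNReal.ofReal_le_ofReal hJ.le
  -- The space-dependent constant A enters only through J; since J ≤ N, it disappears in J + 2N ≤
  -- 3(N + 1).
  set N := max n₀ (max k₁ J) with hN
  have hNn : n₀ ≤ N := le_max_left _ _
  have hNk : k₁ ≤ N := (le_max_left _ _).trans (le_max_right _ _)
  have hNJ : J ≤ N := (le_max_right _ _).trans (le_max_right _ _)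
  let V : ℕ → Finset F.Vertex := fun n => (F.finite_vertices hs n).toFinset
  have hV : ∀ n, N ≤ n → n ≤ 2 * N → ((V n).card : ℝ≥0∞) ≤ q ^ J * q ^ (2 * N) := by
    intro n hn hn2
    have hcard : ((V n).card : ℝ≥0∞) = ((F.vertices n).encard : ℝ≥0∞) := by
      rw [(F.finite_vertices hs n).encard_eq_coe_toFinset_card]
      simp [V]
    rw [hcard]
    refine (hA n ((F.antitone_radius hs (hNk.trans hn)).trans hk₁)).trans ?_
    gcongr
  let T := (Finset.Icc N (2 * N)).biUnion V
  have hcardIcc : (Finset.Icc N (2 * N)).card = N + 1 := by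
    rw [Nat.card_Icc]
    omega
  have hdisj : (↑(Finset.Icc N (2 * N)) : Set ℕ).PairwiseDisjoint V := by
    intro i _ j _ hij
    refine Finset.disjoint_left.2 fun v hi hj => hij ?_
    have h1 : F.level v = i := (F.finite_vertices hs i).mem_toFinset.1 hi
    have h2 : F.level v = j := (F.finite_vertices hs j).mem_toFinset.1 hj
    exact h1.symm.trans h2
  have hTcard : (T.card : ℝ≥0∞) ≤ (N + 1) * (q ^ J * q ^ (2 * N)) := by
    rw [Finset.card_biUnion hdisj]
    push_cast
    calc ∑ n ∈ Finset.Icc N (2 * N), ((V n).card : ℝ≥0∞)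
        ≤ ∑ n ∈ Finset.Icc N (2 * N), q ^ J * q ^ (2 * N) :=
          Finset.sum_le_sum fun n hn => hV n (Finset.mem_Icc.1 hn).1 (Finset.mem_Icc.1 hn).2
      _ = _ := by rw [Finset.sum_const, hcardIcc, nsmul_eq_mul]; push_cast; rfl
  have htotal : ∑ n ∈ Finset.Icc N (2 * N), ∑ v ∈ V n, τ v ^ Q ≤
      ((N : ℝ≥0∞) + 1) * ((3 * q + 1) * κ) := by
    rw [← Finset.sum_biUnion hdisj]
    calc ∑ v ∈ T, τ v ^ Q
        ≤ ((J + 2 * N : ℕ) : ℝ≥0∞) * (q * κ) + T.card * (κ * q⁻¹ ^ (J + 2 * N)) :=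
          sum_rpow_le_of_weakType hQ hs hK0 hK T _
      _ ≤ (3 * ((N : ℝ≥0∞) + 1)) * (q * κ) +
          ((N + 1) * (q ^ J * q ^ (2 * N))) * (κ * q⁻¹ ^ (J + 2 * N)) := by
          gcongr
          have : J + 2 * N ≤ 3 * (N + 1) := by omega
          exact_mod_cast this
      _ = (3 * ((N : ℝ≥0∞) + 1)) * (q * κ) + ((N + 1) * κ) * (q * q⁻¹) ^ (J + 2 * N) := by
          rw [mul_pow, pow_add q]
          ring
      _ = _ := by
          rw [ENNReal.mul_inv_cancel hq0 hqt, one_pow]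
          ring
  -- Pigeonhole: the total over N + 1 levels is at most N + 1 times the claimed bound.
  by_contra! hcon
  have hlt : ∑ n ∈ Finset.Icc N (2 * N), (3 * q + 1) * κ <
      ∑ n ∈ Finset.Icc N (2 * N), ∑ v ∈ V n, τ v ^ Q :=
    ENNReal.sum_lt_sum_of_nonempty ⟨N, Finset.mem_Icc.2 ⟨le_rfl, by omega⟩⟩
      fun n hn => hcon n (hNn.trans (Finset.mem_Icc.1 hn).1)
  rw [Finset.sum_const, hcardIcc, nsmul_eq_mul] at hlt
  push_cast at hlt
  exact absurd htotal (not_le.2 hlt)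

/-- The modulus is bounded by the weak norm of any admissible weight. -/
lemma IsAhlforsRegular.modulus_le_of_weakType (h : IsAhlforsRegular μ Q a b) (hQ : 1 < Q)
    (hs : 1 < s) (F : HyperbolicFilling Z s) {Γ : Set C(I, Z)} {τ : F.Vertex → ℝ≥0∞}
    (hτ : ∀ γ ∈ Γ, F.Admissible τ γ) {K : ℝ≥0} (hK0 : 0 < K)
    (hK : ∀ l : ℝ≥0, 0 < l →
      (({x | (l : ℝ≥0∞) < τ x}.encard : ℕ∞) : ℝ≥0∞) ≤ (K : ℝ≥0∞) ^ Q / (l : ℝ≥0∞) ^ Q) :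
    modulus μ Q Γ ≤ 2 ^ Q * (3 * (4 ^ Q * (ENNReal.ofReal (b * 2 ^ Q) *
      ((3 * ENNReal.ofReal (s ^ Q) + 1) * (K : ℝ≥0∞) ^ Q)))) := by
  have hQ0 : 0 < Q := by linarith
  have hfin : {v | ((1 / 2 : ℝ≥0) : ℝ≥0∞) < τ v}.Finite := by
    rw [← Set.encard_lt_top_iff, ← ENat.toENNReal_lt_top]
    refine (hK (1 / 2) (by positivity)).trans_lt (ENNReal.div_lt_top ?_ ?_)
    · exact ENNReal.rpow_ne_top_of_nonneg hQ0.le ENNReal.coe_ne_top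
    · exact (ENNReal.rpow_pos (ENNReal.coe_pos.2 (by positivity)) ENNReal.coe_ne_top).ne'
  have hlen : ∀ γ ∈ Γ, pathLength γ ≠ 0 := fun γ hγ => (hτ γ hγ).pathLength_ne_zero hs hfin
  rcases Γ.eq_empty_or_nonempty with rfl | ⟨γ₀, hγ₀⟩
  · refine (iInf₂_le (fun _ => 0) ⟨measurable_const, by simp⟩).trans ?_
    simp [ENNReal.zero_rpow_of_pos hQ0]
  have hd : 0 < Metric.diam (univ : Set Z) := by
    refine Metric.diam_nonneg.lt_of_ne fun hd => hlen γ₀ hγ₀ (eVariationOn.constant_on ?_)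
    refine fun x _ y _ => dist_le_zero.1 ?_
    rw [hd]
    exact Metric.dist_le_diam_of_mem isCompact_univ.isBounded (mem_univ x) (mem_univ y)
  obtain ⟨k₁, hk₁⟩ := ((F.tendsto_radius hs).eventually_le_const
    (show (0 : ℝ) < Metric.diam (univ : Set Z) / 2 by positivity)).exists
  choose l hl hlsum using fun N : ℕ => h.exists_level_sum_le hQ0 hs hd F hK0 hK (max N k₁)
  have hlim : Tendsto l atTop atTop :=
    tendsto_atTop_mono (fun N => (le_max_left _ _).trans (hl N)) tendsto_id
  set B₀ := ENNReal.ofReal (b * 2 ^ Q) *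
    ((3 * ENNReal.ofReal (s ^ Q) + 1) * (K : ℝ≥0∞) ^ Q) with hB₀
  have hb := h.2.1
  have h4t : (4 : ℝ≥0∞) ^ Q ≠ ∞ := ENNReal.rpow_ne_top_of_nonneg hQ0.le (by norm_num)
  have hB0 : 4 ^ Q * B₀ ≠ 0 := by
    have h1 : (4 : ℝ≥0∞) ^ Q ≠ 0 := (ENNReal.rpow_pos (by norm_num) (by norm_num)).ne'
    have h2 : ENNReal.ofReal (b * 2 ^ Q) ≠ 0 := (ENNReal.ofReal_pos.2 (by positivity)).ne'
    have h3 : (K : ℝ≥0∞) ^ Q ≠ 0 :=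
      (ENNReal.rpow_pos (ENNReal.coe_pos.2 hK0) ENNReal.coe_ne_top).ne'
    exact mul_ne_zero h1 (mul_ne_zero h2 (mul_ne_zero (by simp) h3))
  have hBt : 4 ^ Q * B₀ ≠ ∞ := by
    refine ENNReal.mul_ne_top h4t (ENNReal.mul_ne_top ENNReal.ofReal_ne_top (ENNReal.mul_ne_top ?_
      (ENNReal.rpow_ne_top_of_nonneg hQ0.le ENNReal.coe_ne_top)))
    exact ENNReal.add_ne_top.2 ⟨ENNReal.mul_ne_top (by norm_num) ENNReal.ofReal_ne_top, by simp⟩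
  -- The factor 4 is 2 from the subdivision lemma times 2 because the projections are only known to
  -- have τ-length above 1/2.
  let ρ : ℕ → Z → ℝ≥0∞ := fun N z => 4 * F.levelFunction τ (l N) z
  have hρint : ∀ N γ, pathIntegral (ρ N) γ = 4 * pathIntegral (F.levelFunction τ (l N)) γ :=
    fun N γ => lintegral_const_mul' _ _ (by norm_num)
  -- Asking for all M ≥ N makes the families increase with N; nonrectifiable paths belong to all of
  -- them.
  let Γ' : ℕ → Set C(I, Z) := fun N =>
    {γ ∈ Γ | IsRectifiable γ → ∀ M ≥ N, 1 ≤ pathIntegral (ρ M) γ}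
  have hΓ' : Monotone Γ' := fun N N' hNN' γ hγ =>
    ⟨hγ.1, fun hr M hM => hγ.2 hr M (hNN'.trans hM)⟩
  have hmod : ∀ N, modulus μ Q (Γ' N) ≤ 4 ^ Q * B₀ := by
    intro N
    refine (iInf₂_le (ρ N) ⟨(F.measurable_levelFunction hs τ _).const_mul _,
      fun γ hγ hr => hγ.2 hr N le_rfl⟩).trans ?_
    simp only [ρ, ENNReal.mul_rpow_of_nonneg _ _ hQ0.le]
    rw [lintegral_const_mul' _ _ h4t]
    gcongr
    refine (h.lintegral_levelFunction_le hQ0 hs F ?_ τ).trans ?_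
    · linarith [F.antitone_radius hs ((le_max_right _ _).trans (hl N))]
    · rw [hB₀]
      gcongr
      exact hlsum N
  refine le_trans (modulus_mono fun γ hγ => ?_) (modulus_iUnion_le hQ hΓ' hB0 hBt hmod)
  by_cases hr : IsRectifiable γ
  · have hpos : 0 < (pathLength γ).toReal := ENNReal.toReal_pos (hlen γ hγ) hr
    have hlt : ((1 / 2 : ℝ≥0) : ℝ≥0∞) < 1 := by
      rw [← ENNReal.coe_one, ENNReal.coe_lt_coe]
      exact NNReal.half_lt_self one_ne_zero
    have hev := (eventually_lt_of_lt_liminf (hlt.trans_le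
      (hτ γ hγ _ (F.isExpandingCovers_vertices hs hlim))) (by isBoundedDefault)).and
      (((F.tendsto_radius hs).comp hlim).eventually_le_const hpos)
    obtain ⟨N, hN⟩ := eventually_atTop.1 hev
    refine mem_iUnion.2 ⟨N, hγ, fun _ M hM => ?_⟩
    obtain ⟨P, hP⟩ := F.exists_projection_tauLength_le hs hr (hN M hM).2 τ
    have h1 := ((hN M hM).1.le.trans (iInf_le _ P)).trans hP
    rw [hρint]
    calc (1 : ℝ≥0∞) = 2 * ((1 / 2 : ℝ≥0) : ℝ≥0∞) := by
          rw [← ENNReal.coe_ofNat, ← ENNReal.coe_mul, mul_one_div_cancel two_ne_zero,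
            ENNReal.coe_one]
      _ ≤ 2 * (2 * pathIntegral (F.levelFunction τ (l M)) γ) := by gcongr
      _ = _ := by ring
  · exact mem_iUnion.2 ⟨0, hγ, fun hr' => absurd hr' hr⟩

end LowerBound

end WeakCovering

end

/-- On a compact, connected, Ahlfors `Q`-regular metric measure space, `Q > 1`, the weak covering
`Q`-capacity of every path family is comparable to its `Q`-modulus, with constants depending only
on `Q`, the parameter `s` of the hyperbolic filling and the Ahlfors regularity constants. -/
theorem theorem1p4 (Q s a b : ℝ) (hQ : 1 < Q) (hs : 1 < s) :
    ∃ c C : ℝ≥0, 0 < c ∧ 0 < C ∧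
      ∀ (Z : Type u) [MetricSpace Z] [CompactSpace Z] [ConnectedSpace Z]
        [MeasurableSpace Z] [BorelSpace Z] (μ : Measure Z),
        WeakCovering.IsAhlforsRegular μ Q a b →
        ∀ (F : WeakCovering.HyperbolicFilling Z s) (Γ : Set C(I, Z)),
          c * WeakCovering.modulus μ Q Γ ≤ F.weakCoveringCapacity Q Γ ∧
            F.weakCoveringCapacity Q Γ ≤ C * WeakCovering.modulus μ Q Γ := by
  have hQ0 : 0 < Q := by linarith
  by_cases hab : 0 < a ∧ 0 < b
  swap
  · exact ⟨1, 1, one_pos, one_pos, fun Z _ _ _ _ _ μ h => absurd ⟨h.1, h.2.1⟩ hab⟩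
  obtain ⟨ha, hb⟩ := hab
  have hsQ : 1 < s ^ Q := Real.one_lt_rpow hs hQ0
  -- the constant of the geometric series with ratio `s ^ (-Q)`
  set G : ℝ := s ^ Q / (s ^ Q - 1) with hGdef
  have hsQ' : 0 < s ^ Q - 1 := by linarith
  have hG1 : 1 ≤ G := (one_le_div hsQ').2 (by linarith)
  have hG : ENNReal.ofReal G + ENNReal.ofReal (s ^ Q) ≤
      ENNReal.ofReal G * ENNReal.ofReal (s ^ Q) := by
    rw [← ENNReal.ofReal_add (by linarith) (by linarith), ← ENNReal.ofReal_mul (by linarith)]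
    refine ENNReal.ofReal_le_ofReal (le_of_eq ?_)
    rw [hGdef]
    field_simp
    ring
  obtain ⟨C, hC⟩ : ∃ C : ℝ≥0, (C : ℝ≥0∞) =
      ENNReal.ofReal (b / a * 6 ^ Q) * (ENNReal.ofReal a)⁻¹ * ENNReal.ofReal G * 4 ^ Q := by
    refine ⟨_, ENNReal.coe_toNNReal (ENNReal.mul_ne_top (ENNReal.mul_ne_top (ENNReal.mul_ne_top
      ENNReal.ofReal_ne_top (ENNReal.inv_ne_top.2 (ENNReal.ofReal_pos.2 ha).ne'))
      ENNReal.ofReal_ne_top) (ENNReal.rpow_ne_top_of_nonneg hQ0.le (by norm_num)))⟩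
  obtain ⟨D, hD⟩ : ∃ D : ℝ≥0, (D : ℝ≥0∞) = 2 ^ Q * (3 * (4 ^ Q * (ENNReal.ofReal (b * 2 ^ Q) *
      (3 * ENNReal.ofReal (s ^ Q) + 1)))) := by
    refine ⟨_, ENNReal.coe_toNNReal (ENNReal.mul_ne_top
      (ENNReal.rpow_ne_top_of_nonneg hQ0.le (by norm_num)) (ENNReal.mul_ne_top (by norm_num)
      (ENNReal.mul_ne_top (ENNReal.rpow_ne_top_of_nonneg hQ0.le (by norm_num))
      (ENNReal.mul_ne_top ENNReal.ofReal_ne_top (ENNReal.add_ne_top.2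
        ⟨ENNReal.mul_ne_top (by norm_num) ENNReal.ofReal_ne_top, ENNReal.one_ne_top⟩)))))⟩
  -- Adding 1 makes positivity immediate and allows division by these constants.
  refine ⟨(D + 1)⁻¹, C + 1, by positivity, by positivity, fun Z _ _ _ _ _ μ h F Γ => ⟨?_, ?_⟩⟩
  · refine le_iInf₂ fun τ hτ => ?_
    -- Taking the Q-th root exposes the infimum over K in the weak norm, so each K can be tested
    -- separately.
    rw [← ENNReal.rpow_inv_le_iff hQ0]
    refine le_iInf₂ fun K hK => ?_
    rw [ENNReal.rpow_inv_le_iff hQ0, ENNReal.coe_inv (by positivity), mul_comm, ← div_eq_mul_inv]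
    refine ENNReal.div_le_of_le_mul' ((h.modulus_le_of_weakType hQ hs F hτ hK.1 hK.2).trans ?_)
    calc _ = (D : ℝ≥0∞) * (K : ℝ≥0∞) ^ Q := by rw [hD]; ring
      _ ≤ _ := by gcongr; exact le_self_add
  · have hne : ((C + 1 : ℝ≥0) : ℝ≥0∞) ≠ 0 := by positivity
    rw [mul_comm, ← ENNReal.div_le_iff_le_mul (Or.inl hne) (Or.inl ENNReal.coe_ne_top)]
    refine le_iInf₂ fun ρ hρ => ?_
    rw [ENNReal.div_le_iff_le_mul (Or.inl hne) (Or.inl ENNReal.coe_ne_top), mul_comm]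
    refine (h.weakCoveringCapacity_le_lintegral hQ0 hs F (ENNReal.one_le_ofReal.2 hG1)
      ENNReal.ofReal_ne_top hG hρ).trans ?_
    rw [← hC]
    gcongr
    exact le_self_add
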